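/- Let $n\in\mathbb N$ and $j=n/2$. Let $\varphi_j:SU(2)\to U(n+1)$ be the spin-$j$ representation, i.e. the irreducible unitary representation of $SU(2)$ of dimension $n+1$, written in the standard basis of weight vectors in which the lowering operator is the matrix $J_-\in M_{\mathbb C}(n+1)$ with entries $\sqrt{n\cdot 1},\sqrt{(n-1)\cdot 2},\dots,\sqrt{1\cdot n}$ just below the diagonal and zeros elsewhere, and the raising operator is $J_+=J_-^{T}$. For $A\in M_{\mathbb C}(n+1)$ and $g\in SU(2)$ put $A^g=\varphi_j(g)A\varphi_j(g^{-1})$; let $SU(2)$ act on the unit sphere $S^2\subset\mathbb R^3$ by rotations through the standard double covering $SU(2)\to SO(3)$, characterized by $(g\mathbf n)\cdot\sigma=g(\mathbf n\cdot\sigma)g^{-1}$ with $\sigma=(\sigma_1,\sigma_2,\sigma_3)$ the Pauli matrices, and let $\mathbf n_0=(0,0,1)$. A symbol correspondence is an injective $\mathbb C$-linear map $P\mapsto W_P$ from $M_{\mathbb C}(n+1)$ to the smooth complex functions on $S^2$ such that for all $P$, all $g\in SU(2)$ and all $\mathbf n\in S^2$: $W_{P^g}(\mathbf n)=W_P(g^{-1}\mathbf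 n)$, $W_{P^*}(\mathbf n)=\overline{W_P(\mathbf n)}$, and $\frac1{4\pi}\int_{S^2}W_P\,dS=\frac1{n+1}\operatorname{trace}(P)$. For $1\le l\le n$ let $$\mathbf e^j(l,0)=\frac{(-1)^l}{l!}\sqrt{2l+1}\,\sqrt{\frac{(n-l)!}{(n+l+1)!}}\;\sum_{k=0}^{l}(-1)^k\binom lk J_-^{\,l-k}J_+^{\,l}J_-^{\,k}.$$ Then: 1. Each $\mathbf e^j(l,0)$, $1\le l\le n$, is a real diagonal matrix of trace $0$ and of unit norm, $\operatorname{trace}(\mathbf e^j(l,0)^*\mathbf e^j(l,0))=1$, and it lies in the summand $M_{\mathbb C}(\varphi_l)$ of type $\varphi_l$ (of dimension $2l+1$) of the $SU(2)$-representation $A\mapsto A^g$ on $M_{\mathbb C}(n+1)$. 2. The formula $W_P(g\mathbf n_0)=\operatorname{trace}(PK^g)$ for all $P\in M_{\mathbb C}(n+1)$, $g\in SU(2)$, defines a bijection $K\mapsto W$ from the set of real diagonal matrices of the form $$K=\frac1{n+1}I+\sum_{l=1}^n c_l\sqrt{\frac{2l+1}{n+1}}\;\mathbf e^j(l,0),\qquad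 c_l\in\mathbb R\setminus\{0\},$$ onto the set of symbol correspondences. 3. In particular, a symbol correspondence is determined by the tuple $(c_1,\dots,c_n)$: $(c_1,\dots,c_n)\mapsto W$ is a bijection from $(\mathbb R\setminus\{0\})^n$ onto the set of symbol correspondences. -/

import Mathlib

open scoped Matrix Manifold ContDiff

noncomputable section

namespace SpinJ

/-- The group `SU(2)`. -/
abbrev SU2 : Type := Matrix.specialUnitaryGroup (Fin 2) ℂ

/-- The matrix algebra `M_ℂ(n+1)`, i.e. the operators on `H_j = ℂ^{n+1}`, `n = 2j`, written in the
standard basis `u(j,j), u(j,j-1), …, u(j,-j)`, which is indexed by `0, 1, …, n`. -/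
abbrev Op (n : ℕ) : Type := Matrix (Fin (n + 1)) (Fin (n + 1)) ℂ

/-! ### The spin-`j` representation of `SU(2)` -/

/-- For `g : ℂ² → ℂ²`, the image of the monomial `e₁^(n-i) e₂^i` under the `n`-th symmetric power
of `g`, namely `(g e₁)^(n-i) (g e₂)^i`, dehomogenized by `e₁ = 1`, `e₂ = X`. -/
def spinPoly (n : ℕ) (g : Matrix (Fin 2) (Fin 2) ℂ) (i : ℕ) : Polynomial ℂ :=
  (Polynomial.C (g 0 0) + Polynomial.C (g 1 0) * Polynomial.X) ^ (n - i) *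
    (Polynomial.C (g 0 1) + Polynomial.C (g 1 1) * Polynomial.X) ^ i

/-- The matrix of the `n`-th symmetric power of `g` in the orthonormal basis
`√(n choose i) e₁^(n-i) e₂^i`, `i = 0, …, n`. With respect to this basis the
infinitesimal raising and lowering operators are the matrices `Jplus n`, `Jminus n` below. -/
def spinMatrix (n : ℕ) (g : Matrix (Fin 2) (Fin 2) ℂ) : Op n :=
  Matrix.of fun k i =>
    ((Real.sqrt (n.choose i) / Real.sqrt (n.choose k) : ℝ) : ℂ) * (spinPoly n g i).coeff k

theorem spinPoly_one (n : ℕ) (i : ℕ) : spinPoly n 1 i = Polynomial.X ^ i := by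
  simp [spinPoly]

theorem spinPoly_natDegree_lt (n : ℕ) (g : Matrix (Fin 2) (Fin 2) ℂ) (i : ℕ) (hi : i ≤ n) :
    (spinPoly n g i).natDegree < n + 1 := by
  have h : ∀ a b : ℂ, (Polynomial.C a + Polynomial.C b * Polynomial.X).natDegree ≤ 1 := by
    intro a b
    rw [add_comm]
    exact Polynomial.natDegree_linear_le
  have h1 := Polynomial.natDegree_pow_le_of_le (n - i) (h (g 0 0) (g 1 0))
  have h2 := Polynomial.natDegree_pow_le_of_le i (h (g 0 1) (g 1 1))
  have h3 := Polynomial.natDegree_mul_le_of_le h1 h2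
  rw [spinPoly]
  omega

theorem spinPoly_mul (n : ℕ) (g h : Matrix (Fin 2) (Fin 2) ℂ) (hg : g.det ≠ 0)
    (i : ℕ) (hi : i ≤ n) :
    spinPoly n (g * h) i =
      ∑ k ∈ Finset.range (n + 1), Polynomial.C ((spinPoly n h i).coeff k) * spinPoly n g k := by
  set a : Polynomial ℂ := Polynomial.C (g 0 0) + Polynomial.C (g 1 0) * Polynomial.X with ha
  set b : Polynomial ℂ := Polynomial.C (g 0 1) + Polynomial.C (g 1 1) * Polynomial.X with hb
  have ha0 : a ≠ 0 := by
    intro h0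
    apply hg
    have e0 : g 0 0 = 0 := by
      have := congrArg (fun p => Polynomial.coeff p 0) h0
      simpa [ha] using this
    have e1 : g 1 0 = 0 := by
      have := congrArg (fun p => Polynomial.coeff p 1) h0
      simpa [ha, Polynomial.coeff_C] using this
    rw [Matrix.det_fin_two, e0, e1]
    ring
  let ι : Polynomial ℂ →+* RatFunc ℂ := algebraMap (Polynomial ℂ) (RatFunc ℂ)
  have hι : Function.Injective ι := RatFunc.algebraMap_injective ℂ
  have hA : ι a ≠ 0 := fun h0 => ha0 (hι (by rw [h0, map_zero]))
  apply hι
  have key : (ι a) ^ n * (spinPoly n h i).eval₂ (ι.comp Polynomial.C) (ι b / ι a) =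
      ι (∑ k ∈ Finset.range (n + 1), Polynomial.C ((spinPoly n h i).coeff k) * spinPoly n g k) := by
    rw [Polynomial.eval₂_eq_sum_range' _ (spinPoly_natDegree_lt n h i hi), Finset.mul_sum, map_sum]
    refine Finset.sum_congr rfl fun k hk => ?_
    have hk' : k ≤ n := by
      have := Finset.mem_range.1 hk
      omega
    have : spinPoly n g k = a ^ (n - k) * b ^ k := rfl
    rw [this, map_mul, map_mul, map_pow, map_pow, div_pow, RingHom.comp_apply]
    have hp : (ι a) ^ n = (ι a) ^ (n - k) * (ι a) ^ k := by rw [← pow_add, Nat.sub_add_cancel hk']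
    rw [hp]
    field_simp
  rw [← key]
  have e1 : ∀ c d : ℂ, ι a * ((ι.comp Polynomial.C) c + (ι.comp Polynomial.C) d * (ι b / ι a)) =
      ι (Polynomial.C c * a + Polynomial.C d * b) := by
    intro c d
    simp only [RingHom.comp_apply, map_add, map_mul]
    field_simp
  have hp : (ι a) ^ n = (ι a) ^ (n - i) * (ι a) ^ i := by rw [← pow_add, Nat.sub_add_cancel hi]
  have e2 : (ι a) ^ n * (spinPoly n h i).eval₂ (ι.comp Polynomial.C) (ι b / ι a) =
      ι ((Polynomial.C (h 0 0) * a + Polynomial.C (h 1 0) * b) ^ (n - i) *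
        (Polynomial.C (h 0 1) * a + Polynomial.C (h 1 1) * b) ^ i) := by
    rw [map_mul, map_pow, map_pow, ← e1, ← e1, mul_pow, mul_pow, hp, spinPoly]
    simp only [Polynomial.eval₂_mul, Polynomial.eval₂_pow, Polynomial.eval₂_add,
      Polynomial.eval₂_C, Polynomial.eval₂_X]
    ring
  rw [e2]
  congr 1
  rw [spinPoly]
  simp only [Matrix.mul_apply, Fin.sum_univ_two, map_add, map_mul, ha, hb]
  congr 2 <;> ring

theorem spinMatrix_one (n : ℕ) : spinMatrix n 1 = 1 := by
  ext k i
  have hne : Real.sqrt (n.choose k) ≠ 0 := by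
    have : 0 < n.choose k := Nat.choose_pos (by omega)
    positivity
  simp only [spinMatrix, Matrix.of_apply, spinPoly_one, Polynomial.coeff_X_pow, Matrix.one_apply]
  by_cases hki : k = i
  · subst hki
    simp [div_self hne]
  · have : (k : ℕ) ≠ (i : ℕ) := fun h => hki (Fin.ext h)
    simp [hki, this]

theorem spinMatrix_mul (n : ℕ) (g h : Matrix (Fin 2) (Fin 2) ℂ) (hg : g.det ≠ 0) :
    spinMatrix n (g * h) = spinMatrix n g * spinMatrix n h := by
  ext k i
  simp only [spinMatrix, Matrix.of_apply, Matrix.mul_apply]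
  rw [spinPoly_mul n g h hg i (by omega), Polynomial.finsetSum_coeff, Finset.sum_range,
    Finset.mul_sum]
  refine Finset.sum_congr rfl fun m _ => ?_
  have hne : ((Real.sqrt (n.choose m) : ℝ) : ℂ) ≠ 0 := by
    have : 0 < n.choose m := Nat.choose_pos (by omega)
    rw [Complex.ofReal_ne_zero]
    positivity
  rw [Polynomial.coeff_C_mul]
  push_cast
  field_simp

/-- The irreducible unitary representation `φ_j : SU(2) → U(n+1)`, `n = 2j`, in matrix form with
respect to the standard basis. -/
def spinRep (n : ℕ) : SU2 →* Op n where
  toFun g := spinMatrix n g.1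
  map_one' := spinMatrix_one n
  map_mul' g h := spinMatrix_mul n g.1 h.1 (by
    rw [(Matrix.mem_specialUnitaryGroup_iff.1 g.2).2]
    exact one_ne_zero)

/-- The action `A ↦ A^g = φ_j(g) A φ_j(g⁻¹)` of `SU(2)` on operators. -/
def opAct (n : ℕ) (g : SU2) (A : Op n) : Op n := spinRep n g * A * spinRep n g⁻¹

/-- `M_ℂ(φ_l) ⊆ M_ℂ(n+1)`: the summand of type `φ_l` (`l` integral, of dimension `2l+1`) of the
operator space, i.e. the sum of the images of all `SU(2)`-equivariant linear maps from the
representation space of `φ_l` to `M_ℂ(n+1)`. -/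
def opSummand (n l : ℕ) : Submodule ℂ (Op n) :=
  Submodule.span ℂ {A | ∃ T : (Fin (2 * l + 1) → ℂ) →ₗ[ℂ] Op n,
    (∀ (g : SU2) (v : Fin (2 * l + 1) → ℂ), T (spinRep (2 * l) g *ᵥ v) = opAct n g (T v)) ∧
      ∃ v, T v = A}

/-! ### The 2-sphere and its rotations -/

/-- Euclidean 3-space. -/
abbrev E3 : Type := EuclideanSpace ℝ (Fin 3)

instance finrank_E3 : Fact (Module.finrank ℝ E3 = 2 + 1) := ⟨by simp⟩

/-- The unit sphere `S² ⊆ ℝ³`. -/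
abbrev S2 : Type := Metric.sphere (0 : E3) 1

/-- `x · σ = x₁ σ₁ + x₂ σ₂ + x₃ σ₃` with the Pauli matrices `σ_k`. -/
def pauli (x : E3) : Matrix (Fin 2) (Fin 2) ℂ :=
  ((x 0 : ℝ) : ℂ) • !![0, 1; 1, 0] + ((x 1 : ℝ) : ℂ) • !![0, -Complex.I; Complex.I, 0] +
    ((x 2 : ℝ) : ℂ) • !![1, 0; 0, -1]

/-- The rotation `ψ(g)` of `ℝ³`, where `ψ : SU(2) → SO(3)` is the standard two-fold covering
homomorphism; it is characterized by `(ψ(g) x) · σ = g (x · σ) g⁻¹`, see `pauli_rotVec`. -/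
def rotVec (g : SU2) (x : E3) : E3 :=
  !₂[((g.1 * pauli x * star g.1) 1 0).re, ((g.1 * pauli x * star g.1) 1 0).im,
    ((g.1 * pauli x * star g.1) 0 0).re]

theorem pauli_eq (x : E3) : pauli x =
    !![((x 2 : ℝ) : ℂ), (x 0 : ℝ) - (x 1 : ℝ) * Complex.I;
      (x 0 : ℝ) + (x 1 : ℝ) * Complex.I, -((x 2 : ℝ) : ℂ)] := by
  ext i j
  fin_cases i <;> fin_cases j <;> (simp [pauli]; try ring)

theorem pauli_rotVec (g : SU2) (x : E3) :
    pauli (rotVec g x) = g.1 * pauli x * star g.1 := by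
  set M := g.1 * pauli x * star g.1 with hM
  have hu : star g.1 * g.1 = 1 :=
    Matrix.mem_unitaryGroup_iff'.1 (Matrix.mem_specialUnitaryGroup_iff.1 g.2).1
  have hH : star M = M := by
    have hp : star (pauli x) = pauli x := by
      rw [pauli_eq]
      ext i j
      fin_cases i <;> fin_cases j <;> (simp [Matrix.star_apply]; try ring)
    rw [hM]
    simp only [star_mul, star_star, hp, mul_assoc]
  have htr : M.trace = 0 := by
    rw [hM, Matrix.trace_mul_comm, ← mul_assoc, hu, one_mul, pauli_eq]
    simp [Matrix.trace_fin_two]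
  rw [Matrix.trace_fin_two] at htr
  have h00 : (M 0 0).im = 0 := by
    have := congrArg (fun N : Matrix (Fin 2) (Fin 2) ℂ => (N 0 0).im) hH
    simp only [Matrix.star_apply, Complex.star_def, Complex.conj_im] at this
    linarith
  have h01 : star (M 1 0) = M 0 1 := congrFun (congrFun hH 0) 1
  have h11 : M 1 1 = -M 0 0 := by linear_combination htr
  have hr0 : (rotVec g x) 0 = (M 1 0).re := rfl
  have hr1 : (rotVec g x) 1 = (M 1 0).im := rfl
  have hr2 : (rotVec g x) 2 = (M 0 0).re := rfl
  rw [pauli_eq, hr0, hr1, hr2]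
  have e00 : (((M 0 0).re : ℝ) : ℂ) = M 0 0 := Complex.ext (by simp) (by simp [h00])
  ext i j
  fin_cases i <;> fin_cases j
  · simpa using e00
  · simp only [Fin.zero_eta, Fin.mk_one, ← h01]
    apply Complex.ext <;> simp
  · simp
  · simpa [h11] using e00

theorem norm_sq_eq_neg_det_pauli (x : E3) : ((‖x‖ ^ 2 : ℝ) : ℂ) = -(pauli x).det := by
  rw [EuclideanSpace.norm_sq_eq, pauli_eq, Matrix.det_fin_two]
  simp only [Fin.sum_univ_three, Real.norm_eq_abs, sq_abs]
  simp
  linear_combination (((x 1 : ℝ) : ℂ) ^ 2) * Complex.I_sq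

theorem norm_rotVec (g : SU2) (x : E3) : ‖rotVec g x‖ = ‖x‖ := by
  have hd : g.1.det = 1 := (Matrix.mem_specialUnitaryGroup_iff.1 g.2).2
  have h : ((‖rotVec g x‖ ^ 2 : ℝ) : ℂ) = ((‖x‖ ^ 2 : ℝ) : ℂ) := by
    rw [norm_sq_eq_neg_det_pauli, norm_sq_eq_neg_det_pauli, pauli_rotVec, Matrix.det_mul,
      Matrix.det_mul, Matrix.star_eq_conjTranspose, Matrix.det_conjTranspose, hd]
    simp
  have h' := Complex.ofReal_injective h
  exact (pow_left_inj₀ (norm_nonneg _) (norm_nonneg _) two_ne_zero).1 h'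

/-- The action of `g ∈ SU(2)` on `S²` through the rotation `ψ(g) ∈ SO(3)`. -/
def rot (g : SU2) (x : S2) : S2 :=
  ⟨rotVec g x.1, by
    have hx : ‖x.1‖ = 1 := by simp
    rw [mem_sphere_zero_iff_norm, norm_rotVec, hx]⟩

/-- The north pole `n₀ = (0,0,1)`. -/
def northPole : S2 := ⟨EuclideanSpace.single 2 1, by simp⟩

/-! ### Symbol correspondences -/

/-- A symbol correspondence for the spin-`j` system, `n = 2j`: a `ℂ`-linear map `P ↦ W_P` from
operators to complex functions on `S²` with the properties below. Since `A ↦ A^g` and `x ↦ g x`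
factor through the surjection `ψ : SU(2) → SO(3)`, equivariance under `SO(3)` is expressed with
`g ∈ SU(2)`. -/
structure IsSymbolCorrespondence (n : ℕ) (W : Op n →ₗ[ℂ] (S2 → ℂ)) : Prop where
  /-- every symbol is a smooth function on the sphere -/
  smooth : ∀ P, ContMDiff (𝓡 2) 𝓘(ℝ, ℂ) ∞ (W P)
  injective : Function.Injective W
  /-- `W_{P^g} = (W_P)^g`, where `F^g(x) = F(g⁻¹ x)` -/
  equivariant : ∀ (g : SU2) (P : Op n) (x : S2), W (opAct n g P) x = W P (rot g⁻¹ x)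
  /-- `W_{P^*}` is the complex conjugate of `W_P` -/
  real : ∀ (P : Op n) (x : S2), W Pᴴ x = star (W P x)
  /-- `(1/4π) ∫_{S²} W_P dS = trace(P)/(n+1)`, with the surface measure `dS` of `S²` -/
  normalized : ∀ P : Op n,
    (1 / (4 * Real.pi) : ℂ) * ∫ x, W P x ∂(MeasureTheory.volume : MeasureTheory.Measure E3).toSphere
      = (1 / (n + 1) : ℂ) * P.trace

/-- `W` is given by the matrix `K` through the formula `W_P(g n₀) = trace(P K^g)`. -/
def IsGivenBy (n : ℕ) (W : Op n →ₗ[ℂ] (S2 → ℂ)) (K : Op n) : Prop :=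
  ∀ (P : Op n) (g : SU2), W P (rot g northPole) = (P * opAct n g K).trace

/-! ### The operator kernels -/

/-- The lowering matrix `J₋`, with entries `√(n·1), √((n-1)·2), …, √(1·n)` just below the
diagonal. -/
def Jminus (n : ℕ) : Op n :=
  Matrix.of fun k i =>
    if (k : ℕ) = i + 1 then ((Real.sqrt (((n : ℝ) - i) * (i + 1)) : ℝ) : ℂ) else 0

/-- The raising matrix `J₊`, the transpose of `J₋`. -/
def Jplus (n : ℕ) : Op n := (Jminus n)ᵀ

/-- The matrix `e^j(l,0)`, `0 ≤ l ≤ n`, `n = 2j`. -/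
def coupled (n l : ℕ) : Op n :=
  (((-1) ^ l / (l.factorial : ℝ) * Real.sqrt (2 * l + 1) *
      Real.sqrt (((n - l).factorial : ℝ) / ((n + l + 1).factorial : ℝ)) : ℝ) : ℂ) •
    ∑ k ∈ Finset.range (l + 1),
      ((-1) ^ k * (l.choose k : ℂ)) • (Jminus n ^ (l - k) * Jplus n ^ l * Jminus n ^ k)

/-- `K = (1/(n+1)) I + ∑_{l=1}^n c_l √((2l+1)/(n+1)) e^j(l,0)`; the tuple `(c_1, …, c_n)` is
indexed by `i = l - 1 ∈ {0, …, n-1}`. -/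
def kernelMatrix (n : ℕ) (c : Fin n → ℝ) : Op n :=
  (1 / (n + 1) : ℂ) • (1 : Op n) +
    ∑ i : Fin n, ((c i * Real.sqrt ((2 * ((i : ℕ) + 1) + 1) / (n + 1)) : ℝ) : ℂ) •
      coupled n ((i : ℕ) + 1)

/-- The real diagonal matrices of type `kernelMatrix n c` with all `c_l ≠ 0`. -/
def kernelSet (n : ℕ) : Set (Op n) :=
  {K | (∃ d : Fin (n + 1) → ℝ, K = Matrix.diagonal fun i => (d i : ℂ)) ∧
    ∃ c : Fin n → ℝ, (∀ i, c i ≠ 0) ∧ K = kernelMatrix n c}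

end SpinJ

end

/-!
The kernels are governed by `sl₂`. Up to a scalar, `e^j(l,0)` is `ad(J₋)^l J₊^l`, where `J₊^l` is a
highest weight vector for the adjoint action. So `e^j(l,0)` is the weight zero vector of the summand
of type `φ_l` that `J₊^l` generates. The trace form is invariant, whence the `e^j(l,0)`,
`0 ≤ l ≤ n`, are orthonormal and form a basis of the diagonal matrices.

Group and Lie algebra are tied together by the coherent vectors, the symmetric powers `w^{⊗n}` of
`w ∈ ℂ²`: they span, `SU(2)` moves them through `w`, and differentiating `w^{⊗n}` along `w` gives
the operators `J`. A subspace of operators that is stable under `SU(2)` is therefore stable under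
commutators with `J₊` and `J₋`, and if it is not zero it contains some `e^j(l,0)`.

Every equivariant `W` has the form `W_P(g n₀) = trace(P K^g)`, where `K` represents the functional
`P ↦ W_P(n₀)`. The stabilizer of `n₀` fixes `K`, so `K` is diagonal; reality makes its coefficients
in the basis real; by Schur's lemma the normalization says `trace K = 1`; and since the operators
`P` with `W_P = 0` form a stable subspace, `W` is injective exactly when no coefficient vanishes.
Conversely a real diagonal `K` is a polynomial `p(J₃)`, and then `W_P(x) = trace(P p(x·J))`, with
`x·J = x₁J₁ + x₂J₂ + x₃J₃`, is a well-defined and smooth function of `x`.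
-/

noncomputable section

namespace SpinJ

open Polynomial LieAlgebra

attribute [local instance] LieRing.ofAssociativeRing

/-! ### Commutators and `sl₂` triples -/

section Commutators

variable {R : Type*} [CommRing R]

theorem lie_ad_pow_eq_smul {L : Type*} [LieRing L] [LieAlgebra R L] {z f a : L}
    {c d : R} (hf : ⁅z, f⁆ = d • f) (ha : ⁅z, a⁆ = c • a) (m : ℕ) :
    ⁅z, (ad R L f ^ m) a⁆ = (c + m * d) • (ad R L f ^ m) a := by
  induction m with
  | zero => simpa using ha
  | succ m ih =>
    rw [pow_succ', Module.End.mul_apply, ad_apply, leibniz_lie, hf, ih, smul_lie, lie_smul,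
      ← add_smul]
    congr 1
    push_cast
    ring

variable {A : Type*} [Ring A] [Algebra R A]

theorem lie_mul (a b c : A) : ⁅a, b * c⁆ = ⁅a, b⁆ * c + b * ⁅a, c⁆ := by
  simp only [Ring.lie_def]
  noncomm_ring

theorem lie_mul_eq_add_smul {z a b : A} {c d : R} (ha : ⁅z, a⁆ = c • a) (hb : ⁅z, b⁆ = d • b) :
    ⁅z, a * b⁆ = (c + d) • (a * b) := by
  rw [lie_mul, ha, hb, smul_mul_assoc, mul_smul_comm, ← add_smul]

theorem lie_pow_eq_smul {z a : A} {c : R} (ha : ⁅z, a⁆ = c • a) (k : ℕ) :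
    ⁅z, a ^ k⁆ = (k * c) • a ^ k := by
  induction k with
  | zero => simp [Ring.lie_def]
  | succ k ih =>
    rw [pow_succ, lie_mul_eq_add_smul ih ha, Nat.cast_succ, add_one_mul]

theorem ad_pow_apply (f a : A) (l : ℕ) :
    (ad R A f ^ l) a = ∑ k ∈ Finset.range (l + 1),
      ((-1) ^ k * (l.choose k : R)) • (f ^ (l - k) * a * f ^ k) := by
  have hneg : -LinearMap.mulRight R f = LinearMap.mulRight R (-f) := by ext; simp
  have had : ad R A f = LinearMap.mulRight R (-f) + LinearMap.mulLeft R f := by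
    rw [ad_eq_lmul_left_sub_lmul_right, ← hneg, Pi.sub_apply, sub_eq_neg_add]
  rw [had, (LinearMap.commute_mulLeft_right (R := R) f (-f)).symm.add_pow, LinearMap.sum_apply]
  refine Finset.sum_congr rfl fun k _ => ?_
  rw [← nsmul_eq_mul', LinearMap.smul_apply, Module.End.mul_apply, LinearMap.pow_mulLeft,
    LinearMap.pow_mulRight, LinearMap.mulLeft_apply, LinearMap.mulRight_apply,
    ← Nat.cast_smul_eq_nsmul R, mul_comm ((-1) ^ k), mul_smul]
  rcases k.even_or_odd with hk | hk <;> simp [hk.neg_pow]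

theorem derivative_pow_eq_lie {p c : A[X]} (h : derivative p = ⁅c, p⁆) (l : ℕ) :
    derivative (p ^ l) = ⁅c, p ^ l⁆ := by
  induction l with
  | zero => simp [Ring.lie_def]
  | succ l ih => rw [pow_succ, derivative_mul, ih, h, lie_mul]

theorem ad_pow_coeff_zero {f : A} {p : A[X]} (h : derivative p = ⁅C f, p⁆) (m : ℕ) :
    (ad R A f ^ m) (p.coeff 0) = (m.factorial : R) • p.coeff m := by
  induction m with
  | zero => simp
  | succ m ih =>
    have hcoeff : ⁅f, p.coeff m⁆ = ((m + 1 : ℕ) : R) • p.coeff (m + 1) := by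
      rw [Nat.cast_smul_eq_nsmul, nsmul_eq_mul', Nat.cast_succ, ← coeff_derivative, h, Ring.lie_def,
        Ring.lie_def, coeff_sub, coeff_C_mul, coeff_mul_C]
    rw [pow_succ', Module.End.mul_apply, ih, map_smul, ad_apply, hcoeff, smul_smul,
      Nat.factorial_succ, mul_comm, Nat.cast_mul]

/-- The polynomial `e - X h - X² f`, which for an `sl₂` triple is `exp (X ad f) e`. -/
def ladderPoly (e f h : A) : A[X] := C e - C h * X - C f * X ^ 2

theorem coeff_zero_ladderPoly_pow (e f h : A) (l : ℕ) : (ladderPoly e f h ^ l).coeff 0 = e ^ l := by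
  rw [show (ladderPoly e f h ^ l).coeff 0 = (ladderPoly e f h).coeff 0 ^ l from
    map_pow constantCoeff _ l]
  simp [ladderPoly]

theorem natDegree_ladderPoly_le (e f h : A) : (ladderPoly e f h).natDegree ≤ 2 := by
  rw [ladderPoly]
  compute_degree

theorem coeff_ladderPoly_pow_two_mul (e f h : A) (l : ℕ) :
    (ladderPoly e f h ^ l).coeff (2 * l) = (-f) ^ l := by
  rw [mul_comm, coeff_pow_of_natDegree_le (natDegree_ladderPoly_le e f h)]
  simp [ladderPoly]

variable {e f h : A}

theorem derivative_ladderPoly (hef : ⁅e, f⁆ = h) (hhf : ⁅h, f⁆ = -(2 • f)) :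
    derivative (ladderPoly e f h) = ⁅C f, ladderPoly e f h⁆ := by
  rw [Ring.lie_def] at hef
  have hhf' : h * f = f * h - 2 • f := by rw [← neg_add_eq_sub, ← hhf, Ring.lie_def]; abel
  ext k
  simp only [ladderPoly, Ring.lie_def, coeff_derivative, coeff_sub, coeff_C_mul, coeff_mul_C,
    coeff_C, coeff_X, coeff_X_pow]
  match k with
  | 0 => simp [← hef]
  | 1 =>
    simp [hhf', mul_add, two_smul]
    abel
  | 2 => simp
  | k + 3 => simp

theorem ad_pow_pow_eq_smul_coeff (hef : ⁅e, f⁆ = h) (hhf : ⁅h, f⁆ = -(2 • f)) (l m : ℕ) :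
    (ad R A f ^ m) (e ^ l) = (m.factorial : R) • (ladderPoly e f h ^ l).coeff m := by
  rw [← coeff_zero_ladderPoly_pow e f h l]
  exact ad_pow_coeff_zero (derivative_pow_eq_lie (derivative_ladderPoly hef hhf) l) m

theorem ad_pow_pow_eq_zero (hef : ⁅e, f⁆ = h) (hhf : ⁅h, f⁆ = -(2 • f)) {l m : ℕ}
    (hlm : 2 * l < m) : (ad R A f ^ m) (e ^ l) = 0 := by
  have hdeg : (ladderPoly e f h ^ l).natDegree ≤ 2 * l := by
    have := natDegree_pow_le_of_le l (natDegree_ladderPoly_le e f h)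
    rwa [mul_comm] at this
  rw [ad_pow_pow_eq_smul_coeff hef hhf, coeff_eq_zero_of_natDegree_lt (hdeg.trans_lt hlm),
    smul_zero]

theorem ad_pow_two_mul_pow (hef : ⁅e, f⁆ = h) (hhf : ⁅h, f⁆ = -(2 • f)) (l : ℕ) :
    (ad R A f ^ (2 * l)) (e ^ l) = ((2 * l).factorial : R) • (-f) ^ l := by
  rw [ad_pow_pow_eq_smul_coeff hef hhf, coeff_ladderPoly_pow_two_mul]

theorem ad_pow_two_mul_aeval (hef : ⁅e, f⁆ = h) (hhf : ⁅h, f⁆ = -(2 • f)) (q : R[X]) :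
    (ad R A f ^ (2 * q.natDegree)) (aeval e q) =
      (q.leadingCoeff * (2 * q.natDegree).factorial) • (-f) ^ q.natDegree := by
  rw [aeval_eq_sum_range, map_sum, Finset.sum_range_succ, Finset.sum_eq_zero fun i hi => ?_,
    map_smul, ad_pow_two_mul_pow hef hhf, smul_smul, zero_add, leadingCoeff]
  have hi : i < q.natDegree := Finset.mem_range.1 hi
  rw [map_smul, ad_pow_pow_eq_zero hef hhf (by omega), smul_zero]

end Commutators

section Trace

variable {m R : Type*} [Fintype m] [CommRing R]

theorem trace_lie (A B : Matrix m m R) : ⁅A, B⁆.trace = 0 := by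
  rw [Ring.lie_def, Matrix.trace_sub, Matrix.trace_mul_comm, sub_self]

theorem trace_eq_zero_of_lie_eq_smul [IsDomain R] {Z A : Matrix m m R} {c : R} (hc : c ≠ 0)
    (h : ⁅Z, A⁆ = c • A) : A.trace = 0 := by
  have htrace := trace_lie Z A
  rw [h, Matrix.trace_smul, smul_eq_mul] at htrace
  exact (mul_eq_zero.1 htrace).resolve_left hc

variable [DecidableEq m]

theorem trace_lie_mul (J A B : Matrix m m R) : (⁅J, A⁆ * B).trace = -(A * ⁅J, B⁆).trace := by
  rw [eq_neg_iff_add_eq_zero, ← Matrix.trace_add, ← lie_mul, trace_lie]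

theorem trace_ad_pow_mul (J A B : Matrix m m R) (k : ℕ) :
    ((ad R _ J ^ k) A * B).trace = (-1) ^ k * (A * (ad R _ J ^ k) B).trace := by
  induction k generalizing A with
  | zero => simp
  | succ k ih =>
    rw [pow_succ, Module.End.mul_apply, ih, ad_apply, trace_lie_mul, ← pow_succ,
      pow_succ' (ad R _ J), Module.End.mul_apply, ad_apply, pow_succ, mul_neg, mul_neg_one, neg_mul]

end Trace

/-! ### The angular momentum matrices -/

/-- The weight matrix `J₃`, with entries `n/2, n/2 - 1, …, -n/2` on the diagonal. -/
def Jz (n : ℕ) : Op n := Matrix.diagonal fun i => (n : ℂ) / 2 - (i : ℕ)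

/-- The entry `√((n - i) (i + 1))` of `Jminus n` below the `i`-th diagonal position. -/
def ladderCoeff (n i : ℕ) : ℂ := (Real.sqrt (((n : ℝ) - i) * (i + 1)) : ℝ)

theorem ladderCoeff_mul_self {n i : ℕ} (hi : i ≤ n) :
    ladderCoeff n i * ladderCoeff n i = ((n : ℂ) - i) * (i + 1) := by
  have hn : (0 : ℝ) ≤ n - i := sub_nonneg.2 (by exact_mod_cast hi)
  rw [ladderCoeff, ← Complex.ofReal_mul, Real.mul_self_sqrt (by positivity)]
  push_cast
  rfl

theorem Jminus_apply (n : ℕ) (k i : Fin (n + 1)) :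
    Jminus n k i = if (k : ℕ) = i + 1 then ladderCoeff n i else 0 := rfl

section MulVec

variable {n : ℕ} (v : Fin (n + 1) → ℂ)

theorem Jminus_mulVec_zero : (Jminus n *ᵥ v) 0 = 0 := by
  simp [Matrix.mulVec, dotProduct, Jminus_apply]

theorem Jminus_mulVec_succ (i : Fin n) :
    (Jminus n *ᵥ v) i.succ = ladderCoeff n i * v i.castSucc := by
  rw [Matrix.mulVec, dotProduct, Finset.sum_eq_single i.castSucc]
  · simp [Jminus_apply]
  · intro k _ hk
    rw [Jminus_apply, if_neg (fun h => hk (Fin.ext (by simpa using h.symm))), zero_mul]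
  · simp

theorem Jplus_mulVec_last : (Jplus n *ᵥ v) (Fin.last n) = 0 := by
  rw [Matrix.mulVec, dotProduct, Finset.sum_eq_zero]
  intro k _
  rw [Jplus, Matrix.transpose_apply, Jminus_apply, if_neg (by simp; omega), zero_mul]

theorem Jplus_mulVec_castSucc (i : Fin n) :
    (Jplus n *ᵥ v) i.castSucc = ladderCoeff n i * v i.succ := by
  rw [Matrix.mulVec, dotProduct, Finset.sum_eq_single i.succ]
  · simp [Jplus, Jminus_apply]
  · intro k _ hk
    rw [Jplus, Matrix.transpose_apply, Jminus_apply,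
      if_neg (fun h => hk (Fin.ext (by simpa using h))), zero_mul]
  · simp

end MulVec

theorem Jplus_mul_diagonal_mul_Jminus (n : ℕ) (d : ℕ → ℂ) :
    Jplus n * Matrix.diagonal (fun i : Fin (n + 1) => d i) * Jminus n =
      Matrix.diagonal fun i : Fin (n + 1) =>
        ((n : ℂ) - (i : ℕ)) * ((i : ℕ) + 1) * d ((i : ℕ) + 1) := by
  refine Matrix.ext_iff_mulVec.2 fun v => funext fun i => ?_
  rw [← Matrix.mulVec_mulVec, ← Matrix.mulVec_mulVec, Matrix.mulVec_diagonal]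
  cases i using Fin.lastCases with
  | last => simp [Jplus_mulVec_last]
  | cast i =>
    rw [Jplus_mulVec_castSucc, Matrix.mulVec_diagonal, Jminus_mulVec_succ, Fin.val_castSucc,
      Fin.val_succ, ← ladderCoeff_mul_self i.2.le]
    ring

theorem Jminus_mul_Jplus (n : ℕ) : Jminus n * Jplus n =
    Matrix.diagonal fun i : Fin (n + 1) => ((n : ℂ) - (i : ℕ) + 1) * (i : ℕ) := by
  refine Matrix.ext_iff_mulVec.2 fun v => funext fun i => ?_
  rw [← Matrix.mulVec_mulVec, Matrix.mulVec_diagonal]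
  cases i using Fin.cases with
  | zero => simp [Jminus_mulVec_zero]
  | succ i =>
    rw [Jminus_mulVec_succ, Jplus_mulVec_castSucc, ← mul_assoc, ladderCoeff_mul_self i.2.le,
      Fin.val_succ]
    push_cast
    ring

theorem Jplus_lie_Jminus (n : ℕ) : ⁅Jplus n, Jminus n⁆ = (2 : ℂ) • Jz n := by
  have h := Jplus_mul_diagonal_mul_Jminus n 1
  simp only [Pi.one_apply, Matrix.diagonal_one, mul_one] at h
  rw [Ring.lie_def, h, Jminus_mul_Jplus, Jz, Matrix.diagonal_sub, ← Matrix.diagonal_smul]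
  congr 1
  ext i
  simp only [Pi.smul_apply, smul_eq_mul]
  ring

theorem Jz_lie_apply {n : ℕ} (A : Op n) (k i : Fin (n + 1)) :
    ⁅Jz n, A⁆ k i = ((i : ℕ) - (k : ℕ)) * A k i := by
  rw [Ring.lie_def, Matrix.sub_apply, Jz, Matrix.mul_diagonal, Matrix.diagonal_mul]
  ring

theorem apply_eq_zero_of_Jz_lie_eq_zero {n : ℕ} {A : Op n} (hA : ⁅Jz n, A⁆ = 0)
    {k i : Fin (n + 1)} (hki : k ≠ i) : A k i = 0 := by
  have h := Jz_lie_apply A k i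
  rw [hA, Matrix.zero_apply, zero_eq_mul, sub_eq_zero] at h
  exact h.resolve_left fun h => hki (Fin.ext (by exact_mod_cast h.symm))

theorem Jz_lie_Jminus (n : ℕ) : ⁅Jz n, Jminus n⁆ = (-1 : ℂ) • Jminus n := by
  ext k i
  rw [Jz_lie_apply, Matrix.smul_apply, Jminus_apply]
  split_ifs with h
  · simp [h]
  · simp

theorem Jz_lie_Jplus (n : ℕ) : ⁅Jz n, Jplus n⁆ = (1 : ℂ) • Jplus n := by
  ext k i
  rw [Jz_lie_apply, Matrix.smul_apply, Jplus, Matrix.transpose_apply, Jminus_apply]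
  split_ifs with h
  · simp [h]
  · simp

theorem two_smul_Jz_lie_Jminus (n : ℕ) : ⁅(2 : ℂ) • Jz n, Jminus n⁆ = -(2 • Jminus n) := by
  rw [Ring.lie_def, smul_mul_assoc, mul_smul_comm, ← smul_sub, ← Ring.lie_def, Jz_lie_Jminus,
    smul_smul, mul_neg_one, neg_smul, ofNat_smul_eq_nsmul]

theorem Jminus_lie_Jplus (n : ℕ) : ⁅Jminus n, Jplus n⁆ = -((2 : ℂ) • Jz n) := by
  rw [← lie_skew, Jplus_lie_Jminus]

theorem neg_two_smul_Jz_lie_Jplus (n : ℕ) :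
    ⁅-((2 : ℂ) • Jz n), Jplus n⁆ = -(2 • Jplus n) := by
  rw [neg_lie, Ring.lie_def, smul_mul_assoc, mul_smul_comm, ← smul_sub, ← Ring.lie_def,
    Jz_lie_Jplus, one_smul, ofNat_smul_eq_nsmul]

theorem Jminus_conjTranspose (n : ℕ) : (Jminus n)ᴴ = Jplus n := by
  ext k i
  rw [Matrix.conjTranspose_apply, Jplus, Matrix.transpose_apply, Jminus_apply, ladderCoeff]
  split_ifs <;> simp

theorem Jplus_conjTranspose (n : ℕ) : (Jplus n)ᴴ = Jminus n := by
  rw [← Jminus_conjTranspose, Matrix.conjTranspose_conjTranspose]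

theorem Jz_conjTranspose (n : ℕ) : (Jz n)ᴴ = Jz n := by
  rw [Jz, Matrix.diagonal_conjTranspose]
  congr 1
  ext i
  simp

theorem Jplus_pow_mul_Jminus_pow (n l : ℕ) : Jplus n ^ l * Jminus n ^ l =
    Matrix.diagonal fun i : Fin (n + 1) =>
      (((n - i : ℕ).descFactorial l * (i + 1 : ℕ).ascFactorial l : ℕ) : ℂ) := by
  induction l with
  | zero => simp
  | succ l ih =>
    rw [pow_succ' (Jplus n), pow_succ, mul_assoc, ← mul_assoc (Jplus n ^ l), ih, ← mul_assoc,
      Jplus_mul_diagonal_mul_Jminus n fun i =>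
        ((n - i).descFactorial l * (i + 1).ascFactorial l : ℕ)]
    congr 1
    ext i
    have hdesc : (n - i : ℕ).descFactorial (l + 1) = (n - i) * (n - (i + 1)).descFactorial l := by
      rw [← Nat.sub_sub]
      cases n - i with
      | zero => simp
      | succ k => rw [Nat.succ_descFactorial_succ, Nat.add_sub_cancel]
    have hasc : (i + 1 : ℕ).ascFactorial (l + 1) = (i + 1) * (i + 1 + 1 : ℕ).ascFactorial l := by
      rw [Nat.ascFactorial_succ, ← Nat.succ_ascFactorial]
    rw [hdesc, hasc]
    push_cast [Nat.lt_succ_iff.1 i.2]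
    ring

theorem sum_choose_mul_choose_antidiagonal (l m : ℕ) :
    ∑ x ∈ Finset.HasAntidiagonal.antidiagonal m, (l + x.1).choose l * (l + x.2).choose l =
      (2 * l + 1 + m).choose (2 * l + 1) := by
  have h := congrArg (fun u : (PowerSeries ℤ)ˣ => PowerSeries.coeff m (u : PowerSeries ℤ))
    (PowerSeries.invOneSubPow_add (S := ℤ) (l + 1) (l + 1))
  rw [show l + 1 + (l + 1) = 2 * l + 1 + 1 by ring] at h
  simp only [Units.val_mul, PowerSeries.invOneSubPow_val_succ_eq_mk_add_choose,
    PowerSeries.coeff_mul, PowerSeries.coeff_mk] at h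
  exact_mod_cast h.symm

theorem sum_descFactorial_mul_ascFactorial {n l : ℕ} (hl : l ≤ n) :
    ∑ i ∈ Finset.range (n + 1), (n - i).descFactorial l * (i + 1).ascFactorial l =
      l.factorial ^ 2 * (n + l + 1).choose (2 * l + 1) := by
  have hsum := sum_choose_mul_choose_antidiagonal l (n - l)
  rw [Finset.Nat.sum_antidiagonal_eq_sum_range_succ_mk,
    show 2 * l + 1 + (n - l) = n + l + 1 by omega] at hsum
  have hsub : Finset.range (n - l + 1) ⊆ Finset.range (n + 1) :=
    Finset.range_subset_range.2 (by omega)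
  rw [← Finset.sum_subset hsub, ← hsum, Finset.mul_sum]
  · refine Finset.sum_congr rfl fun i hi => ?_
    have hi := Finset.mem_range.1 hi
    rw [Nat.descFactorial_eq_factorial_mul_choose, Nat.ascFactorial_eq_factorial_mul_choose,
      show l + (n - l - i) = n - i by omega, add_comm i l]
    ring
  · intro i hin hi
    rw [Finset.mem_range] at hin hi
    rw [Nat.descFactorial_eq_zero_iff_lt.2 (by omega), zero_mul]

theorem trace_Jplus_pow_mul_Jminus_pow {n l : ℕ} (hl : l ≤ n) :
    (Jplus n ^ l * Jminus n ^ l).trace =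
      ((l.factorial ^ 2 * (n + l + 1).choose (2 * l + 1) : ℕ) : ℂ) := by
  rw [Jplus_pow_mul_Jminus_pow, Matrix.trace_diagonal, ← Nat.cast_sum, Fin.sum_univ_eq_sum_range
    (fun i => (n - i).descFactorial l * (i + 1).ascFactorial l),
    sum_descFactorial_mul_ascFactorial hl]

theorem Jminus_pow_ne_zero {n l : ℕ} (hl : l ≤ n) : Jminus n ^ l ≠ 0 := by
  intro h
  have htrace := trace_Jplus_pow_mul_Jminus_pow hl
  rw [h, mul_zero, Matrix.trace_zero, eq_comm, Nat.cast_eq_zero] at htrace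
  exact (Nat.mul_pos (by positivity) (Nat.choose_pos (by omega))).ne' htrace

open scoped ComplexOrder in
theorem Jminus_pow_eq_zero (n : ℕ) : Jminus n ^ (n + 1) = 0 := by
  rw [← Matrix.conjTranspose_mul_self_eq_zero, Matrix.conjTranspose_pow, Jminus_conjTranspose,
    Jplus_pow_mul_Jminus_pow, ← Matrix.diagonal_zero]
  congr 1
  ext i
  rw [Nat.descFactorial_eq_zero_iff_lt.2 (by omega), zero_mul, Nat.cast_zero]

theorem Jplus_pow_eq_zero (n : ℕ) : Jplus n ^ (n + 1) = 0 := by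
  rw [← Jminus_conjTranspose, ← Matrix.conjTranspose_pow, Jminus_pow_eq_zero,
    Matrix.conjTranspose_zero]

/-! ### The matrices `e^j(l,0)` -/

/-- The normalization factor of `coupled n l`. -/
def coupledCoeff (n l : ℕ) : ℝ :=
  (-1) ^ l / (l.factorial : ℝ) * Real.sqrt (2 * l + 1) *
    Real.sqrt (((n - l).factorial : ℝ) / ((n + l + 1).factorial : ℝ))

theorem coupledCoeff_sq (n l : ℕ) : coupledCoeff n l ^ 2 =
    (2 * l + 1) * ((n - l).factorial / (n + l + 1).factorial) / (l.factorial : ℝ) ^ 2 := by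
  rw [coupledCoeff, mul_pow, mul_pow, Real.sq_sqrt (by positivity), Real.sq_sqrt (by positivity),
    div_pow, ← pow_mul, mul_comm l, pow_mul]
  ring

theorem coupled_eq_smul_ad_pow (n l : ℕ) :
    coupled n l = (coupledCoeff n l : ℂ) • (ad ℂ _ (Jminus n) ^ l) (Jplus n ^ l) := by
  rw [ad_pow_apply]
  rfl

theorem coupled_zero (n : ℕ) : coupled n 0 = ((Real.sqrt (1 / (n + 1)) : ℝ) : ℂ) • (1 : Op n) := by
  rw [coupled_eq_smul_ad_pow]
  simp only [pow_zero, Module.End.one_apply, coupledCoeff]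
  congr 2
  simp [Nat.factorial_succ]
  field_simp

theorem Jz_lie_ad_pow (n l m : ℕ) :
    ⁅Jz n, (ad ℂ _ (Jminus n) ^ m) (Jplus n ^ l)⁆ =
      ((l : ℂ) - m) • (ad ℂ _ (Jminus n) ^ m) (Jplus n ^ l) := by
  convert lie_ad_pow_eq_smul (Jz_lie_Jminus n) (lie_pow_eq_smul (Jz_lie_Jplus n) l) m using 2
  ring

theorem trace_ad_pow_mul_ad_pow_of_lt {n l l' m m' : ℕ} (h : 2 * l' < m + m') :
    ((ad ℂ _ (Jminus n) ^ m) (Jplus n ^ l) * (ad ℂ _ (Jminus n) ^ m') (Jplus n ^ l')).trace =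
      0 := by
  rw [trace_ad_pow_mul, ← Module.End.mul_apply, ← pow_add,
    ad_pow_pow_eq_zero (Jplus_lie_Jminus n) (two_smul_Jz_lie_Jminus n) h, mul_zero,
    Matrix.trace_zero, mul_zero]

theorem trace_ad_pow_mul_ad_pow_of_ne {n l l' m m' : ℕ} (h : l + l' ≠ m + m') :
    ((ad ℂ _ (Jminus n) ^ m) (Jplus n ^ l) * (ad ℂ _ (Jminus n) ^ m') (Jplus n ^ l')).trace =
      0 := by
  refine trace_eq_zero_of_lie_eq_smul ?_
    (lie_mul_eq_add_smul (Jz_lie_ad_pow n l m) (Jz_lie_ad_pow n l' m'))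
  rw [sub_add_sub_comm, sub_ne_zero]
  exact_mod_cast h

theorem trace_coupled_mul_ad_pow {n l l' : ℕ} (h : l ≠ l') (m : ℕ) :
    (coupled n l * (ad ℂ _ (Jminus n) ^ m) (Jplus n ^ l')).trace = 0 := by
  rw [coupled_eq_smul_ad_pow, smul_mul_assoc, Matrix.trace_smul, smul_eq_mul]
  refine mul_eq_zero_of_right _ ?_
  rcases eq_or_ne m l' with rfl | hm
  · rcases lt_or_gt_of_ne h with h | h
    · rw [Matrix.trace_mul_comm]
      exact trace_ad_pow_mul_ad_pow_of_lt (by omega)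
    · exact trace_ad_pow_mul_ad_pow_of_lt (by omega)
  · exact trace_ad_pow_mul_ad_pow_of_ne (by omega)

theorem trace_coupled_mul_coupled_of_ne {n l l' : ℕ} (h : l ≠ l') :
    (coupled n l * coupled n l').trace = 0 := by
  rw [coupled_eq_smul_ad_pow n l', mul_smul_comm, Matrix.trace_smul, trace_coupled_mul_ad_pow h,
    smul_zero]

theorem trace_ad_pow_mul_self {n l : ℕ} (hl : l ≤ n) :
    ((ad ℂ _ (Jminus n) ^ l) (Jplus n ^ l) * (ad ℂ _ (Jminus n) ^ l) (Jplus n ^ l)).trace =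
      (((2 * l).factorial * (l.factorial ^ 2 * (n + l + 1).choose (2 * l + 1)) : ℕ) : ℂ) := by
  rw [trace_ad_pow_mul, ← Module.End.mul_apply, ← pow_add, ← two_mul,
    ad_pow_two_mul_pow (Jplus_lie_Jminus n) (two_smul_Jz_lie_Jminus n),
    ← neg_one_smul ℂ (Jminus n), _root_.smul_pow, smul_comm, mul_smul_comm, mul_smul_comm,
    Matrix.trace_smul, Matrix.trace_smul, trace_Jplus_pow_mul_Jminus_pow hl, smul_eq_mul,
    ← mul_assoc, ← mul_pow, neg_one_mul, neg_neg, one_pow, one_mul, smul_eq_mul,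
    Nat.cast_mul (Nat.factorial _)]

theorem coupledCoeff_sq_mul {n l : ℕ} (hl : l ≤ n) : coupledCoeff n l ^ 2 *
    ((2 * l).factorial * (l.factorial ^ 2 * (n + l + 1).choose (2 * l + 1)) : ℕ) = 1 := by
  have hchoose := Nat.choose_mul_factorial_mul_factorial (show 2 * l + 1 ≤ n + l + 1 by omega)
  rw [show n + l + 1 - (2 * l + 1) = n - l by omega, Nat.factorial_succ (2 * l)] at hchoose
  rw [coupledCoeff_sq]
  push_cast
  field_simp
  rw_mod_cast [← hchoose]
  ring

theorem trace_coupled_mul_self {n l : ℕ} (hl : l ≤ n) :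
    (coupled n l * coupled n l).trace = 1 := by
  rw [coupled_eq_smul_ad_pow, smul_mul_smul_comm, Matrix.trace_smul, trace_ad_pow_mul_self hl,
    smul_eq_mul, ← sq]
  exact_mod_cast coupledCoeff_sq_mul hl

theorem trace_coupled {n l : ℕ} (hl : 1 ≤ l) : (coupled n l).trace = 0 := by
  simpa using trace_coupled_mul_ad_pow (n := n) (l := l) (l' := 0) (by omega) 0

theorem Jz_lie_coupled (n l : ℕ) : ⁅Jz n, coupled n l⁆ = 0 := by
  rw [coupled_eq_smul_ad_pow, lie_smul, Jz_lie_ad_pow, sub_self, zero_smul, smul_zero]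

theorem mapMatrix_conj_smul {n : ℕ} (c : ℂ) (A : Op n) :
    (starRingEnd ℂ).mapMatrix (c • A) = starRingEnd ℂ c • (starRingEnd ℂ).mapMatrix A :=
  Matrix.map_smul' _ c A (map_mul _)

theorem mapMatrix_conj_Jminus (n : ℕ) : (starRingEnd ℂ).mapMatrix (Jminus n) = Jminus n := by
  ext k i
  rw [RingHom.mapMatrix_apply, Matrix.map_apply, Jminus_apply, ladderCoeff]
  split_ifs <;> simp

theorem mapMatrix_conj_Jplus (n : ℕ) : (starRingEnd ℂ).mapMatrix (Jplus n) = Jplus n :=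
  congrArg Matrix.transpose (mapMatrix_conj_Jminus n)

theorem conj_coupled_apply (n l : ℕ) (k i : Fin (n + 1)) :
    starRingEnd ℂ (coupled n l k i) = coupled n l k i := by
  have h : (starRingEnd ℂ).mapMatrix (coupled n l) = coupled n l := by
    simp only [coupled, mapMatrix_conj_smul, map_sum, map_mul, map_pow, mapMatrix_conj_Jminus,
      mapMatrix_conj_Jplus, Complex.conj_ofReal, map_neg, map_one, map_natCast]
  exact congrFun (congrFun h k) i

/-- The diagonal entries of `coupled n l`. -/
def coupledDiag (n l : ℕ) (i : Fin (n + 1)) : ℝ := (coupled n l i i).re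

theorem coupled_eq_diagonal (n l : ℕ) :
    coupled n l = Matrix.diagonal fun i => (coupledDiag n l i : ℂ) := by
  ext k i
  rcases eq_or_ne k i with rfl | hki
  · rw [Matrix.diagonal_apply_eq]
    exact (Complex.conj_eq_iff_re.1 (conj_coupled_apply n l k k)).symm
  · rw [Matrix.diagonal_apply_ne _ hki, apply_eq_zero_of_Jz_lie_eq_zero (Jz_lie_coupled n l) hki]

theorem coupled_conjTranspose (n l : ℕ) : (coupled n l)ᴴ = coupled n l := by
  rw [coupled_eq_diagonal, Matrix.diagonal_conjTranspose]
  congr 1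
  ext i
  simp

/-! ### Coherent vectors -/

section HomEval

variable {R A : Type*} [CommRing R] [Ring A] [Algebra R A] (a b : R)

/-- The value at `(a, b)` of the homogenization in degree `d` of a polynomial of degree `≤ d` whose
coefficients need not commute. -/
def homEval (d : ℕ) : A[X] →ₗ[R] A :=
  ∑ k ∈ Finset.range (d + 1), (a ^ (d - k) * b ^ k) • (lcoeff A k).restrictScalars R

theorem homEval_apply (d : ℕ) (p : A[X]) : homEval a b d p =
    ∑ k ∈ Finset.range (d + 1), (a ^ (d - k) * b ^ k) • p.coeff k := by
  simp [homEval]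

theorem homEval_C_mul_X_pow {d k : ℕ} (hk : k ≤ d) (r : A) :
    homEval a b d (C r * X ^ k) = (a ^ (d - k) * b ^ k) • r := by
  rw [homEval_apply, Finset.sum_eq_single_of_mem k (Finset.mem_range.2 (by omega))]
  · rw [coeff_C_mul_X_pow, if_pos rfl]
  · intro m _ hm
    rw [coeff_C_mul_X_pow, if_neg hm, smul_zero]

theorem homEval_C_mul_X_pow_mul {d d' k : ℕ} (hk : k ≤ d) (r : A) {q : A[X]}
    (hq : q.natDegree ≤ d') :
    homEval a b (d + d') (C r * X ^ k * q) = homEval a b d (C r * X ^ k) * homEval a b d' q := by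
  refine induction_with_natDegree_le (fun q => homEval a b (d + d') (C r * X ^ k * q) =
    homEval a b d (C r * X ^ k) * homEval a b d' q) d' ?_ (fun m s _ hm => ?_)
    (fun q₁ q₂ _ _ h₁ h₂ => ?_) q hq
  · simp only [mul_zero, map_zero]
  · rw [← mul_assoc, mul_assoc (C r), X_pow_mul, ← mul_assoc, ← C_mul, mul_assoc, ← pow_add,
      homEval_C_mul_X_pow a b (add_le_add hk hm), homEval_C_mul_X_pow a b hk,
      homEval_C_mul_X_pow a b hm, smul_mul_smul_comm,
      show d + d' - (k + m) = d - k + (d' - m) by omega,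
      pow_add, pow_add, mul_mul_mul_comm]
  · rw [mul_add, map_add, h₁, h₂, map_add, mul_add]

theorem homEval_mul {d d' : ℕ} {p q : A[X]} (hp : p.natDegree ≤ d) (hq : q.natDegree ≤ d') :
    homEval a b (d + d') (p * q) = homEval a b d p * homEval a b d' q := by
  refine induction_with_natDegree_le (fun p => homEval a b (d + d') (p * q) =
    homEval a b d p * homEval a b d' q) d ?_
    (fun k r _ hk => homEval_C_mul_X_pow_mul a b hk r hq) (fun p₁ p₂ _ _ h₁ h₂ => ?_) p hp
  · simp only [zero_mul, map_zero]
  · rw [add_mul, map_add, h₁, h₂, map_add, add_mul]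

theorem homEval_pow {d : ℕ} {p : A[X]} (hp : p.natDegree ≤ d) (l : ℕ) :
    homEval a b (l * d) (p ^ l) = homEval a b d p ^ l := by
  induction l with
  | zero => simp [homEval_apply]
  | succ l ih => rw [pow_succ, Nat.succ_mul, homEval_mul a b (natDegree_pow_le_of_le l hp) hp, ih,
      pow_succ]

theorem coeff_linear_pow (n k : ℕ) :
    ((C a + C b * X) ^ n).coeff k = n.choose k * a ^ (n - k) * b ^ k := by
  have h : C a + C b * X = (X + C a).comp (C b * X) := by simp [add_comm]
  rw [h, ← pow_comp, comp_C_mul_X_coeff, coeff_X_add_C_pow]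
  ring

end HomEval

/-- The coherent vector `w^n` in the `n`-th symmetric power of `ℂ²`. -/
def coherent (n : ℕ) (w : Fin 2 → ℂ) : Fin (n + 1) → ℂ :=
  fun k => (Real.sqrt (n.choose k) : ℂ) * (w 0 ^ (n - k : ℕ) * w 1 ^ (k : ℕ))

theorem sqrt_choose_mul_self (n k : ℕ) :
    (Real.sqrt (n.choose k) : ℂ) * (Real.sqrt (n.choose k) : ℂ) = n.choose k := by
  rw [← Complex.ofReal_mul, Real.mul_self_sqrt (Nat.cast_nonneg _), Complex.ofReal_natCast]

theorem sqrt_choose_ne_zero {n k : ℕ} (hk : k ≤ n) : (Real.sqrt (n.choose k) : ℂ) ≠ 0 := by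
  intro h
  have h' := sqrt_choose_mul_self n k
  rw [h, zero_mul, eq_comm, Nat.cast_eq_zero] at h'
  exact (Nat.choose_pos hk).ne' h'

theorem span_range_coherent (n : ℕ) : Submodule.span ℂ (Set.range (coherent n)) = ⊤ := by
  by_contra h
  obtain ⟨f, hf, hle⟩ := Submodule.exists_le_ker_of_lt_top _ (lt_top_iff_ne_top.2 h)
  have hcoeff : (fun k : Fin (n + 1) => (Real.sqrt (n.choose k) : ℂ) * f (Pi.single k 1)) = 0 := by
    refine Matrix.eq_zero_of_forall_index_sum_pow_mul_eq_zero
      (f := fun j : Fin (n + 1) => ((j : ℕ) : ℂ)) (Nat.cast_injective.comp Fin.val_injective) ?_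
    intro j
    have hj : f (coherent n ![1, (j : ℕ)]) = 0 := hle (Submodule.subset_span ⟨_, rfl⟩)
    rw [LinearMap.pi_apply_eq_sum_univ f] at hj
    rw [← hj]
    refine Finset.sum_congr rfl fun k _ => ?_
    have : (fun j => if k = j then (1 : ℂ) else 0) = Pi.single k 1 := by
      ext j
      simp [Pi.single_apply, eq_comm]
    rw [this]
    simp [coherent]
    ring
  refine hf (LinearMap.pi_ext' fun k => LinearMap.ext_ring ?_)
  exact (mul_eq_zero.1 (congrFun hcoeff k)).resolve_left
    (sqrt_choose_ne_zero (Nat.lt_succ_iff.1 k.2))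

theorem spinMatrix_mulVec_coherent (n : ℕ) (g : Matrix (Fin 2) (Fin 2) ℂ) (w : Fin 2 → ℂ) :
    spinMatrix n g *ᵥ coherent n w = coherent n (g *ᵥ w) := by
  have hbinom : ∑ i : Fin (n + 1), C ((n.choose i : ℂ) * (w 0 ^ (n - i : ℕ) * w 1 ^ (i : ℕ))) *
      spinPoly n g i = (C ((g *ᵥ w) 0) + C ((g *ᵥ w) 1) * X) ^ n := by
    have h : C ((g *ᵥ w) 0) + C ((g *ᵥ w) 1) * X =
        C (w 1) * (C (g 0 1) + C (g 1 1) * X) + C (w 0) * (C (g 0 0) + C (g 1 0) * X) := by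
      simp only [Matrix.mulVec, dotProduct, Fin.sum_univ_two, map_add, map_mul]
      ring
    rw [h, add_pow, Finset.sum_range]
    refine Finset.sum_congr rfl fun i _ => ?_
    rw [spinPoly, mul_pow, mul_pow]
    simp only [map_mul, map_pow, C_eq_natCast]
    ring
  ext k
  have hk := congrArg (fun p => coeff p k) hbinom
  simp only [finsetSum_coeff, coeff_C_mul, coeff_linear_pow] at hk
  have hne := sqrt_choose_ne_zero (Nat.lt_succ_iff.1 k.2)
  refine mul_left_cancel₀ hne ?_
  rw [coherent, ← mul_assoc, sqrt_choose_mul_self, ← mul_assoc, ← hk, Matrix.mulVec, dotProduct,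
    Finset.mul_sum]
  refine Finset.sum_congr rfl fun i _ => ?_
  rw [spinMatrix, Matrix.of_apply, coherent, ← sqrt_choose_mul_self n i]
  push_cast
  field_simp

theorem ladderCoeff_mul_sqrt_choose {n i : ℕ} (hi : i < n) :
    ladderCoeff n i * (Real.sqrt (n.choose i) : ℂ) = (i + 1) * Real.sqrt (n.choose (i + 1)) := by
  have hn : (0 : ℝ) ≤ n - i := sub_nonneg.2 (by exact_mod_cast hi.le)
  have hchoose : ((n - i) * (i + 1) * n.choose i : ℝ) = (i + 1) ^ 2 * n.choose (i + 1) := by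
    have h := Nat.choose_succ_right_eq n i
    rify [hi.le] at h
    linear_combination -(i + 1 : ℝ) * h
  have h : √((n - i) * (i + 1) : ℝ) * √(n.choose i) = (i + 1) * √(n.choose (i + 1)) := by
    rw [← Real.sqrt_mul (by positivity), hchoose, Real.sqrt_mul (by positivity),
      Real.sqrt_sq (by positivity)]
  rw [ladderCoeff, ← Complex.ofReal_mul, h]
  push_cast
  rfl

theorem ladderCoeff_mul_sqrt_choose_succ {n i : ℕ} (hi : i < n) :
    ladderCoeff n i * (Real.sqrt (n.choose (i + 1)) : ℂ) = (n - i) * Real.sqrt (n.choose i) := by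
  have h := ladderCoeff_mul_sqrt_choose hi
  have hsq := ladderCoeff_mul_self hi.le
  have hi' : ((i : ℂ) + 1) ≠ 0 := Nat.cast_add_one_ne_zero i
  refine mul_left_cancel₀ hi' ?_
  linear_combination -ladderCoeff n i * h + (Real.sqrt (n.choose i) : ℂ) * hsq

theorem Jplus_mulVec_coherent_apply (n : ℕ) (w : Fin 2 → ℂ) (k : Fin (n + 1)) :
    (Jplus n *ᵥ coherent n w) k = (Real.sqrt (n.choose k) : ℂ) *
      ((n - k : ℕ) * w 0 ^ (n - k - 1 : ℕ) * w 1 * w 1 ^ (k : ℕ)) := by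
  cases k using Fin.lastCases with
  | last => simp [Jplus_mulVec_last]
  | cast i =>
    rw [Jplus_mulVec_castSucc, coherent, ← mul_assoc, Fin.val_succ, Fin.val_castSucc,
      ladderCoeff_mul_sqrt_choose_succ i.2, Nat.cast_sub i.2.le, ← Nat.sub_sub]
    ring

theorem Jminus_mulVec_coherent_apply (n : ℕ) (w : Fin 2 → ℂ) (k : Fin (n + 1)) :
    (Jminus n *ᵥ coherent n w) k = (Real.sqrt (n.choose k) : ℂ) *
      (w 0 ^ (n - k : ℕ) * ((k : ℕ) * w 1 ^ (k - 1 : ℕ) * w 0)) := by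
  cases k using Fin.cases with
  | zero => simp [Jminus_mulVec_zero]
  | succ i =>
    rw [Jminus_mulVec_succ, coherent, ← mul_assoc, Fin.val_succ, Fin.val_castSucc,
      ladderCoeff_mul_sqrt_choose i.2, Nat.add_sub_cancel,
      show n - (i : ℕ) = n - (i + 1) + 1 by omega, pow_succ]
    push_cast
    ring

/-- The derivative at the identity, in the direction `X`, of the `n`-th symmetric power. -/
def dspin (n : ℕ) (X : Matrix (Fin 2) (Fin 2) ℂ) : Op n :=
  ((X 0 0 + X 1 1) * (n / 2)) • (1 : Op n) + (X 0 0 - X 1 1) • Jz n + X 0 1 • Jplus n +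
    X 1 0 • Jminus n

theorem natCast_mul_pow_pred_mul (m : ℕ) (z : ℂ) : m * z ^ (m - 1) * z = m * z ^ m := by
  cases m with
  | zero => simp
  | succ m => rw [Nat.add_sub_cancel, mul_assoc, ← pow_succ]

theorem hasDerivAt_coherent (n : ℕ) {γ : ℝ → Fin 2 → ℂ} {X : Matrix (Fin 2) (Fin 2) ℂ} {t : ℝ}
    (hγ : HasDerivAt γ (X *ᵥ γ t) t) :
    HasDerivAt (fun s => coherent n (γ s)) (dspin n X *ᵥ coherent n (γ t)) t := by
  rw [hasDerivAt_pi] at hγ ⊢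
  intro k
  have hk : (k : ℕ) ≤ n := Nat.lt_succ_iff.1 k.2
  refine HasDerivAt.congr_deriv
    ((((hγ 0).pow (n - k)).mul ((hγ 1).pow k)).const_mul (Real.sqrt (n.choose k) : ℂ)) ?_
  simp only [dspin, Matrix.add_mulVec, Matrix.smul_mulVec, Matrix.one_mulVec, Pi.add_apply,
    Pi.smul_apply, smul_eq_mul, Jplus_mulVec_coherent_apply, Jminus_mulVec_coherent_apply, Jz,
    Matrix.mulVec_diagonal]
  have h0 := natCast_mul_pow_pred_mul (n - k) (γ t 0)
  have h1 := natCast_mul_pow_pred_mul k (γ t 1)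
  rw [Nat.cast_sub hk] at h0 ⊢
  simp only [coherent, Matrix.mulVec, dotProduct, Fin.sum_univ_two, Pi.pow_apply]
  linear_combination (X 0 0 * (Real.sqrt (n.choose k) : ℂ) * γ t 1 ^ (k : ℕ)) * h0 +
    X 1 1 * (Real.sqrt (n.choose k) : ℂ) * γ t 0 ^ (n - k : ℕ) * h1

theorem eq_of_mulVec_coherent_eq {n : ℕ} {M N : Op n}
    (h : ∀ w, M *ᵥ coherent n w = N *ᵥ coherent n w) : M = N := by
  refine Matrix.ext_iff_mulVec.2 fun v => ?_
  have hv : v ∈ Submodule.span ℂ (Set.range (coherent n)) := span_range_coherent n ▸ trivial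
  refine LinearMap.eqOn_span (f := M.mulVecLin) (g := N.mulVecLin) ?_ hv
  rintro _ ⟨w, rfl⟩
  exact h w

theorem hasDerivAt_spinMatrix_mulVec (n : ℕ) {γ : ℝ → Matrix (Fin 2) (Fin 2) ℂ}
    {X : Matrix (Fin 2) (Fin 2) ℂ} {t : ℝ}
    (hγ : ∀ w, HasDerivAt (fun s => γ s *ᵥ w) (X *ᵥ (γ t *ᵥ w)) t) (v : Fin (n + 1) → ℂ) :
    HasDerivAt (fun s => spinMatrix n (γ s) *ᵥ v) (dspin n X *ᵥ (spinMatrix n (γ t) *ᵥ v)) t := by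
  have hv : v ∈ Submodule.span ℂ (Set.range (coherent n)) := span_range_coherent n ▸ trivial
  induction hv using Submodule.span_induction with
  | mem v hv =>
    obtain ⟨w, rfl⟩ := hv
    simp only [spinMatrix_mulVec_coherent]
    exact hasDerivAt_coherent n (hγ w)
  | zero => simpa only [Matrix.mulVec_zero] using hasDerivAt_const t (0 : Fin (n + 1) → ℂ)
  | add v v' _ _ hv hv' => simpa only [Matrix.mulVec_add] using hv.fun_add hv'
  | smul c v _ hv => simpa only [Matrix.mulVec_smul] using hv.fun_const_smul c

theorem hasDerivAt_add_smul {E : Type*} [NormedAddCommGroup E] [NormedSpace ℝ E] (v u : E) :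
    HasDerivAt (fun t : ℝ => v + t • u) u 0 := by
  simpa using ((hasDerivAt_id (0 : ℝ)).smul_const u).const_add v

theorem hasDerivAt_coherent_add_smul (n : ℕ) (X : Matrix (Fin 2) (Fin 2) ℂ) (w : Fin 2 → ℂ) :
    HasDerivAt (fun t : ℝ => coherent n (w + t • (X *ᵥ w))) (dspin n X *ᵥ coherent n w) 0 := by
  have h := hasDerivAt_coherent n (X := X) (t := 0) (γ := fun t : ℝ => w + t • (X *ᵥ w))
    (by simpa using hasDerivAt_add_smul w (X *ᵥ w))
  simpa using h

theorem spinMatrix_mul_dspin (n : ℕ) {g X Y : Matrix (Fin 2) (Fin 2) ℂ} (h : g * X = Y * g) :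
    spinMatrix n g * dspin n X = dspin n Y * spinMatrix n g := by
  refine eq_of_mulVec_coherent_eq fun w => ?_
  have hX := hasDerivAt_coherent_add_smul n X w
  have hY := hasDerivAt_coherent_add_smul n Y (g *ᵥ w)
  have hg := (spinMatrix n g).mulVecLin.toContinuousLinearMap.restrictScalars ℝ
    |>.hasFDerivAt.comp_hasDerivAt 0 hX
  rw [← Matrix.mulVec_mulVec, ← Matrix.mulVec_mulVec, spinMatrix_mulVec_coherent]
  refine hg.unique (hY.congr_of_eventuallyEq (.of_forall fun t => ?_))
  change spinMatrix n g *ᵥ coherent n (w + t • (X *ᵥ w)) = _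
  rw [spinMatrix_mulVec_coherent, Matrix.mulVec_add, Matrix.mulVec_smul, Matrix.mulVec_mulVec, h,
    ← Matrix.mulVec_mulVec]

/-! ### The summands of the operator space -/

/-- The linear map from the space of `φ_l` to the operators that takes the coherent vector of `w`
to the `l`-th power of the image of `nilp w` under `dspin n`. -/
def ladderMap (n l : ℕ) : (Fin (2 * l + 1) → ℂ) →ₗ[ℂ] Op n :=
  ∑ k : Fin (2 * l + 1), (LinearMap.proj k : (Fin (2 * l + 1) → ℂ) →ₗ[ℂ] ℂ).smulRight
    ((Real.sqrt ((2 * l).choose k) : ℂ)⁻¹ •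
      (ladderPoly (Jplus n) (Jminus n) ((2 : ℂ) • Jz n) ^ l).coeff k)

/-- The nilpotent matrix `w wᵀ ε`, where `ε` is the invariant symplectic form on `ℂ²`. -/
def nilp (w : Fin 2 → ℂ) : Matrix (Fin 2) (Fin 2) ℂ :=
  !![-(w 0 * w 1), w 0 ^ 2; -w 1 ^ 2, w 0 * w 1]

theorem mul_nilp {g : Matrix (Fin 2) (Fin 2) ℂ} (hg : g.det = 1) (w : Fin 2 → ℂ) :
    g * nilp w = nilp (g *ᵥ w) * g := by
  rw [Matrix.det_fin_two] at hg
  ext i j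
  fin_cases i <;> fin_cases j <;>
    simp [nilp, Matrix.mul_apply, Fin.sum_univ_two, Matrix.mulVec, dotProduct]
  · linear_combination (w 1 * (g 0 0 * w 0 + g 0 1 * w 1)) * hg
  · linear_combination (-w 0 * (g 0 0 * w 0 + g 0 1 * w 1)) * hg
  · linear_combination (w 1 * (g 1 0 * w 0 + g 1 1 * w 1)) * hg
  · linear_combination (-w 0 * (g 1 0 * w 0 + g 1 1 * w 1)) * hg

theorem homEval_ladderPoly (n : ℕ) (w : Fin 2 → ℂ) :
    homEval (w 0) (w 1) 2 (ladderPoly (Jplus n) (Jminus n) ((2 : ℂ) • Jz n)) =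
      dspin n (nilp w) := by
  simp [homEval_apply, ladderPoly, Finset.sum_range_succ, coeff_X, coeff_C, dspin, nilp]
  module

theorem ladderMap_apply (n l : ℕ) (v : Fin (2 * l + 1) → ℂ) : ladderMap n l v =
    ∑ k, v k • (Real.sqrt ((2 * l).choose k) : ℂ)⁻¹ •
      (ladderPoly (Jplus n) (Jminus n) ((2 : ℂ) • Jz n) ^ l).coeff k := by
  simp only [ladderMap, LinearMap.sum_apply, LinearMap.smulRight_apply, LinearMap.proj_apply]

theorem ladderMap_coherent (n l : ℕ) (w : Fin 2 → ℂ) :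
    ladderMap n l (coherent (2 * l) w) = dspin n (nilp w) ^ l := by
  rw [← homEval_ladderPoly, ← homEval_pow _ _ (natDegree_ladderPoly_le _ _ _), mul_comm l,
    homEval_apply, ladderMap_apply, Finset.sum_range]
  refine Finset.sum_congr rfl fun k _ => ?_
  rw [coherent, smul_smul, mul_right_comm,
    mul_inv_cancel₀ (sqrt_choose_ne_zero (Nat.lt_succ_iff.1 k.2)), one_mul]

theorem spinRep_apply (n : ℕ) (g : SU2) : spinRep n g = spinMatrix n g.1 := rfl

theorem SU2.det_eq_one (g : SU2) : g.1.det = 1 := (Matrix.mem_specialUnitaryGroup_iff.1 g.2).2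

theorem spinRep_mul_inv (n : ℕ) (g : SU2) : spinRep n g * spinRep n g⁻¹ = 1 := by
  rw [← map_mul, mul_inv_cancel, map_one]

theorem spinRep_inv_mul (n : ℕ) (g : SU2) : spinRep n g⁻¹ * spinRep n g = 1 := by
  rw [← map_mul, inv_mul_cancel, map_one]

theorem opAct_eq_of_semiconjBy {n : ℕ} {g : SU2} {A B : Op n}
    (h : SemiconjBy (spinRep n g) A B) : opAct n g A = B := by
  rw [opAct, h.eq, mul_assoc, spinRep_mul_inv, mul_one]

/-- The action `A ↦ A^g` as a linear map. -/
def opActLin (n : ℕ) (g : SU2) : Op n →ₗ[ℂ] Op n :=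
  LinearMap.mulRight ℂ (spinRep n g⁻¹) ∘ₗ LinearMap.mulLeft ℂ (spinRep n g)

theorem opActLin_apply (n : ℕ) (g : SU2) (A : Op n) : opActLin n g A = opAct n g A := rfl

theorem ladderMap_equivariant (n l : ℕ) (g : SU2) (v : Fin (2 * l + 1) → ℂ) :
    ladderMap n l (spinRep (2 * l) g *ᵥ v) = opAct n g (ladderMap n l v) := by
  suffices h : ladderMap n l ∘ₗ (spinRep (2 * l) g).mulVecLin = opActLin n g ∘ₗ ladderMap n l from
    LinearMap.congr_fun h v
  refine LinearMap.ext_on (span_range_coherent (2 * l)) ?_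
  rintro _ ⟨w, rfl⟩
  have hconj : SemiconjBy (spinRep n g) (dspin n (nilp w)) (dspin n (nilp (g.1 *ᵥ w))) :=
    spinMatrix_mul_dspin n (mul_nilp g.det_eq_one w)
  rw [LinearMap.comp_apply, LinearMap.comp_apply, Matrix.mulVecLin_apply, spinRep_apply,
    spinMatrix_mulVec_coherent, ladderMap_coherent, ladderMap_coherent, opActLin_apply,
    opAct_eq_of_semiconjBy (hconj.pow_right l)]

theorem ladderMap_single (n : ℕ) {l m : ℕ} (hm : m < 2 * l + 1) :
    ladderMap n l (Pi.single ⟨m, hm⟩ (m.factorial * Real.sqrt ((2 * l).choose m) : ℂ)) =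
      (ad ℂ _ (Jminus n) ^ m) (Jplus n ^ l) := by
  rw [ladderMap_apply, Finset.sum_eq_single ⟨m, hm⟩]
  · rw [Pi.single_eq_same, smul_smul, mul_assoc,
      mul_inv_cancel₀ (sqrt_choose_ne_zero (Nat.lt_succ_iff.1 hm)), mul_one,
      ad_pow_pow_eq_smul_coeff (Jplus_lie_Jminus n) (two_smul_Jz_lie_Jminus n)]
  · intro k _ hk
    rw [Pi.single_eq_of_ne hk, zero_smul]
  · simp

theorem coupled_mem_range_ladderMap (n l : ℕ) :
    coupled n l ∈ LinearMap.range (ladderMap n l) := by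
  rw [coupled_eq_smul_ad_pow, ← ladderMap_single n (show l < 2 * l + 1 by omega)]
  exact Submodule.smul_mem _ _ (LinearMap.mem_range_self _ _)

theorem coupled_mem_opSummand (n l : ℕ) : coupled n l ∈ opSummand n l :=
  Submodule.subset_span ⟨ladderMap n l, ladderMap_equivariant n l, coupled_mem_range_ladderMap n l⟩

theorem trace_coupled_mul_ladderMap {n l l' : ℕ} (h : l ≠ l') (v : Fin (2 * l' + 1) → ℂ) :
    (coupled n l * ladderMap n l' v).trace = 0 := by
  suffices h : Matrix.traceLinearMap _ ℂ ℂ ∘ₗ LinearMap.mulLeft ℂ (coupled n l) ∘ₗ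
      ladderMap n l' = 0 from LinearMap.congr_fun h v
  refine (Pi.basisFun ℂ _).ext fun m => ?_
  have hm : (m.1.factorial * Real.sqrt ((2 * l').choose m) : ℂ) ≠ 0 := mul_ne_zero
    (Nat.cast_ne_zero.2 (Nat.factorial_ne_zero _)) (sqrt_choose_ne_zero (Nat.lt_succ_iff.1 m.2))
  refine (mul_eq_zero.1 (?_ : _ * _ = (0 : ℂ))).resolve_left hm
  have key := trace_coupled_mul_ad_pow (n := n) h m
  rw [← ladderMap_single n m.2] at key
  rw [← smul_eq_mul, ← map_smul, Pi.basisFun_apply, ← Pi.single_smul', smul_eq_mul, mul_one]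
  exact key

theorem trace_coupled_mul_opAct_coupled {n l l' : ℕ} (h : l ≠ l') (g : SU2) :
    (coupled n l * opAct n g (coupled n l')).trace = 0 := by
  obtain ⟨v, hv⟩ := coupled_mem_range_ladderMap n l'
  rw [← hv, ← ladderMap_equivariant, trace_coupled_mul_ladderMap h]

/-! ### Subspaces stable under the ladder operators -/

section Nilpotent

variable {K V : Type*} [Field K] [AddCommGroup V] [Module K V] {f : Module.End K V}

theorem exists_mem_ne_zero_apply_eq_zero (hf : IsNilpotent f) {Q : Submodule K V} (hQ : Q ≠ ⊥)
    (hfQ : ∀ x ∈ Q, f x ∈ Q) : ∃ x ∈ Q, x ≠ 0 ∧ f x = 0 := by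
  obtain ⟨x, hx, hx0⟩ := Q.exists_mem_ne_zero_of_ne_bot hQ
  obtain ⟨m, hm⟩ := hf
  by_contra! hinj
  have hpow (k : ℕ) : (f ^ k) x ≠ 0 := by
    induction k with
    | zero => exact hx0
    | succ k ih =>
      rw [pow_succ', Module.End.mul_apply]
      exact hinj _ (Module.End.pow_apply_mem_of_forall_mem k hfQ x hx) ih
  exact hpow m (by rw [hm, LinearMap.zero_apply])

theorem eq_zero_of_aeval_apply_eq_zero {d : ℕ} (hf : f ^ (d + 1) = 0) {v : V}
    (hv : (f ^ d) v ≠ 0) {q : K[X]} (hq : q.natDegree ≤ d) (hqv : aeval f q v = 0) : q = 0 := by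
  have hcoeff (k : ℕ) (hk : k ≤ d) : q.coeff k = 0 := by
    induction k using Nat.strong_induction_on with
    | h k ih =>
      obtain ⟨r, rfl⟩ := X_pow_dvd_iff.2 fun i hi => ih i hi (hi.le.trans hk)
      have hr : X ^ (d - k) * (X ^ k * r) = divX r * X ^ (d + 1) + C (r.coeff 0) * X ^ d := by
        rw [← mul_assoc, ← pow_add, Nat.sub_add_cancel hk]
        nth_rw 1 [← divX_mul_X_add r]
        ring
      have key : r.coeff 0 • (f ^ d) v = 0 := by
        have h := congrArg (fun p => aeval f p v) hr
        rw [map_mul, Module.End.mul_apply, hqv, map_zero] at h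
        simpa [hf] using h.symm
      simpa [coeff_X_pow_mul'] using (smul_eq_zero.1 key).resolve_right hv
  refine ext fun k => (le_or_gt k d).elim (hcoeff k) fun hk => ?_
  exact coeff_eq_zero_of_natDegree_lt (hq.trans_lt hk)

-- A vector with `f ^ d v ≠ 0` is cyclic, so an operator commuting with `f` is determined there.
theorem exists_eq_aeval_of_commute {d : ℕ} (hd : Module.finrank K V = d + 1) (hf : f ^ (d + 1) = 0)
    (hfd : f ^ d ≠ 0) {g : Module.End K V} (hg : Commute g f) :
    ∃ q : K[X], q.natDegree ≤ d ∧ g = aeval f q := by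
  obtain ⟨v, hv⟩ := DFunLike.ne_iff.1 hfd
  have : FiniteDimensional K V := .of_finrank_pos (by omega)
  let ev : degreeLT K (d + 1) →ₗ[K] V :=
    LinearMap.applyₗ v ∘ₗ (aeval f).toLinearMap ∘ₗ (degreeLT K (d + 1)).subtype
  have hdeg (q : degreeLT K (d + 1)) : q.1.natDegree ≤ d :=
    natDegree_le_of_degree_le (mem_degreeLE.1 ((degreeLT_succ_eq_degreeLE (R := K)).le q.2))
  have hinj : Function.Injective ev := (injective_iff_map_eq_zero ev).2 fun q hq =>
    Subtype.ext (eq_zero_of_aeval_apply_eq_zero hf hv (hdeg q) hq)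
  have hsurj : Function.Surjective ev :=
    (LinearMap.injective_iff_surjective_of_finrank_eq_finrank (by
      rw [(degreeLTEquiv K (d + 1)).finrank_eq, Module.finrank_fin_fun, hd])).1 hinj
  obtain ⟨q, hq⟩ := hsurj (g v)
  refine ⟨q, hdeg q, LinearMap.ext fun w => ?_⟩
  obtain ⟨r, rfl⟩ := hsurj w
  have hgr : Commute g (aeval f r.1) := by
    rw [aeval_eq_sum_range]
    exact Commute.sum_right _ _ _ fun k _ => (hg.pow_right k).smul_right _
  change g (aeval f r.1 v) = aeval f q.1 (aeval f r.1 v)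
  rw [← Module.End.mul_apply, hgr.eq, Module.End.mul_apply, ← hq, ← Module.End.mul_apply,
    ← map_mul, mul_comm, map_mul]
  rfl

end Nilpotent

theorem ad_pow_mem {R L : Type*} [CommRing R] [LieRing L] [LieAlgebra R L] {f : L}
    {Q : Submodule R L} (hQ : ∀ a ∈ Q, ⁅f, a⁆ ∈ Q) {a : L} (ha : a ∈ Q) (m : ℕ) :
    (ad R L f ^ m) a ∈ Q :=
  Module.End.pow_apply_mem_of_forall_mem m hQ a ha

section Ladder

variable {K A : Type*} [Field K] [CharZero K]

theorem leadingCoeff_mul_factorial_ne_zero {q : K[X]} (hq : q ≠ 0) :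
    q.leadingCoeff * ((2 * q.natDegree).factorial : K) ≠ 0 :=
  mul_ne_zero (leadingCoeff_ne_zero.2 hq) (Nat.cast_ne_zero.2 (Nat.factorial_ne_zero _))

variable [Ring A] [Algebra K A] {e f h : A} {Q : Submodule K A}

theorem pow_natDegree_mem_of_aeval_mem (hef : ⁅e, f⁆ = h) (hhf : ⁅h, f⁆ = -(2 • f))
    (hQ : ∀ a ∈ Q, ⁅f, a⁆ ∈ Q) {q : K[X]} (hq : q ≠ 0) (hqQ : aeval e q ∈ Q) :
    f ^ q.natDegree ∈ Q := by
  have key := ad_pow_mem hQ hqQ (2 * q.natDegree)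
  rw [ad_pow_two_mul_aeval hef hhf,
    Q.smul_mem_iff (leadingCoeff_mul_factorial_ne_zero hq), neg_pow] at key
  rcases neg_one_pow_eq_or A q.natDegree with hs | hs <;> simpa [hs] using key

end Ladder

theorem Jplus_pow_ne_zero {n l : ℕ} (hl : l ≤ n) : Jplus n ^ l ≠ 0 := by
  rw [Jplus, ← Matrix.transpose_pow, Ne, Matrix.transpose_eq_zero]
  exact Jminus_pow_ne_zero hl

theorem exists_eq_aeval_of_Jplus_lie_eq_zero {n : ℕ} {A : Op n} (hA : ⁅Jplus n, A⁆ = 0) :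
    ∃ q : ℂ[X], q.natDegree ≤ n ∧ A = aeval (Jplus n) q := by
  let φ : Op n ≃ₐ[ℂ] Module.End ℂ (Fin (n + 1) → ℂ) := Matrix.toLinAlgEquiv'
  have hnil : φ (Jplus n) ^ (n + 1) = 0 := by rw [← map_pow, Jplus_pow_eq_zero, map_zero]
  have hne : φ (Jplus n) ^ n ≠ 0 := by
    rw [← map_pow, map_ne_zero_iff φ φ.injective]
    exact Jplus_pow_ne_zero le_rfl
  obtain ⟨q, hq, hAq⟩ := exists_eq_aeval_of_commute (Module.finrank_fin_fun ℂ) hnil hne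
    ((show Commute A (Jplus n) from (sub_eq_zero.1 hA).symm).map φ)
  exact ⟨q, hq, φ.injective (hAq.trans (aeval_algHom_apply φ _ _))⟩

theorem eq_smul_one_of_lie_eq_zero {n : ℕ} {A : Op n} (hp : ⁅Jplus n, A⁆ = 0)
    (hm : ⁅Jminus n, A⁆ = 0) : ∃ c : ℂ, A = c • 1 := by
  obtain ⟨q, hq, rfl⟩ := exists_eq_aeval_of_Jplus_lie_eq_zero hp
  have hzero : q.natDegree = 0 := by
    by_contra hpos
    have hlead := leadingCoeff_mul_factorial_ne_zero
      (ne_zero_of_natDegree_gt (Nat.pos_of_ne_zero hpos))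
    have key : (ad ℂ _ (Jminus n) ^ (2 * q.natDegree)) (aeval (Jplus n) q) = 0 :=
      Module.End.pow_map_zero_of_le (k := 1) (by omega) (by rwa [pow_one])
    rw [ad_pow_two_mul_aeval (Jplus_lie_Jminus n) (two_smul_Jz_lie_Jminus n)] at key
    refine Jminus_pow_ne_zero hq ?_
    simpa [neg_pow (Jminus n)] using (smul_eq_zero.1 key).resolve_left hlead
  exact ⟨q.coeff 0, by rw [eq_C_of_natDegree_eq_zero hzero, aeval_C, coeff_C_zero,
    Algebra.algebraMap_eq_smul_one]⟩

theorem exists_coupled_mem {n : ℕ} {Q : Submodule ℂ (Op n)} (hQ : Q ≠ ⊥)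
    (hp : ∀ A ∈ Q, ⁅Jplus n, A⁆ ∈ Q) (hm : ∀ A ∈ Q, ⁅Jminus n, A⁆ ∈ Q) :
    ∃ l ≤ n, coupled n l ∈ Q := by
  have hnil : IsNilpotent (ad ℂ _ (Jplus n)) :=
    ad_nilpotent_of_nilpotent ⟨n + 1, Jplus_pow_eq_zero n⟩
  obtain ⟨A, hAQ, hA0, hA⟩ := exists_mem_ne_zero_apply_eq_zero hnil hQ hp
  obtain ⟨q, hq, rfl⟩ := exists_eq_aeval_of_Jplus_lie_eq_zero hA
  have hq0 : q ≠ 0 := by rintro rfl; exact hA0 (map_zero _)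
  have hminus : Jminus n ^ q.natDegree ∈ Q :=
    pow_natDegree_mem_of_aeval_mem (Jplus_lie_Jminus n) (two_smul_Jz_lie_Jminus n) hm hq0 hAQ
  have hplus : Jplus n ^ q.natDegree ∈ Q := by
    have h := pow_natDegree_mem_of_aeval_mem (q := X ^ q.natDegree) (Jminus_lie_Jplus n)
      (neg_two_smul_Jz_lie_Jplus n) hp (pow_ne_zero _ X_ne_zero) (by rwa [map_pow, aeval_X])
    rwa [natDegree_X_pow] at h
  refine ⟨q.natDegree, hq, ?_⟩
  rw [coupled_eq_smul_ad_pow]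
  exact Q.smul_mem _ (ad_pow_mem hm hplus _)

/-! ### Expansion of diagonal matrices -/

theorem sum_coupledDiag_mul_coupledDiag {n : ℕ} (l l' : Fin (n + 1)) :
    ∑ i, coupledDiag n l i * coupledDiag n l' i = if l = l' then 1 else 0 := by
  have h : (coupled n l * coupled n l').trace =
      ((∑ i, coupledDiag n l i * coupledDiag n l' i : ℝ) : ℂ) := by
    rw [coupled_eq_diagonal, coupled_eq_diagonal, Matrix.diagonal_mul_diagonal,
      Matrix.trace_diagonal]
    push_cast
    rfl
  split_ifs with hl
  · rw [hl, trace_coupled_mul_self (by omega)] at h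
    rw [hl]
    exact_mod_cast h.symm
  · rw [trace_coupled_mul_coupled_of_ne (mt Fin.ext hl)] at h
    exact_mod_cast h.symm

theorem sum_smul_coupled_eq_diagonal {n : ℕ} (κ : Fin (n + 1) → ℝ) :
    ∑ l : Fin (n + 1), (κ l : ℂ) • coupled n l =
      Matrix.diagonal fun i => ((∑ l : Fin (n + 1), κ l * coupledDiag n l i : ℝ) : ℂ) := by
  simp only [coupled_eq_diagonal, ← Matrix.diagonal_smul]
  ext k i
  rw [Matrix.sum_apply]
  simp only [Matrix.diagonal_apply]
  split_ifs <;> simp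

theorem exists_diagonal_eq_sum_coupled {n : ℕ} (d : Fin (n + 1) → ℝ) :
    ∃ κ : Fin (n + 1) → ℝ,
      (Matrix.diagonal fun i => (d i : ℂ) : Op n) = ∑ l : Fin (n + 1), (κ l : ℂ) • coupled n l := by
  let M : Matrix (Fin (n + 1)) (Fin (n + 1)) ℝ := Matrix.of fun l i => coupledDiag n l i
  have hM : M * Mᵀ = 1 := by
    ext l l'
    rw [Matrix.mul_apply, Matrix.one_apply]
    exact sum_coupledDiag_mul_coupledDiag l l'
  refine ⟨M *ᵥ d, ?_⟩
  rw [sum_smul_coupled_eq_diagonal]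
  congr! 3 with i
  calc d i = (Mᵀ *ᵥ (M *ᵥ d)) i := by
        rw [Matrix.mulVec_mulVec, mul_eq_one_comm.1 hM, Matrix.one_mulVec]
    _ = ((M *ᵥ d) ᵥ* M) i := by rw [Matrix.mulVec_transpose]
    _ = ∑ l, (M *ᵥ d) l * coupledDiag n l i := rfl

theorem trace_coupled_mul_sum_coupled {n : ℕ} (κ : Fin (n + 1) → ℂ) (l : Fin (n + 1)) :
    (coupled n l * ∑ l' : Fin (n + 1), κ l' • coupled n l').trace = κ l := by
  rw [Finset.mul_sum, Matrix.trace_sum, Finset.sum_eq_single l]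
  · rw [mul_smul_comm, Matrix.trace_smul, trace_coupled_mul_self (by omega), smul_eq_mul, mul_one]
  · intro l' _ h
    rw [mul_smul_comm, Matrix.trace_smul,
      trace_coupled_mul_coupled_of_ne (fun h' => h (Fin.ext h'.symm)), smul_zero]
  · simp

/-- The coefficients of `kernelMatrix n c` with respect to the matrices `coupled n l`,
`l = 0, …, n`. -/
def kernelCoeff (n : ℕ) (c : Fin n → ℝ) : Fin (n + 1) → ℝ :=
  Fin.cons (Real.sqrt (1 / (n + 1)))
    fun i => c i * Real.sqrt ((2 * ((i : ℕ) + 1) + 1) / (n + 1))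

theorem kernelMatrix_eq_sum_coupled (n : ℕ) (c : Fin n → ℝ) :
    kernelMatrix n c = ∑ l : Fin (n + 1), (kernelCoeff n c l : ℂ) • coupled n l := by
  have hsqrt : Real.sqrt (1 / (n + 1)) * Real.sqrt (1 / (n + 1)) = (1 / (n + 1) : ℝ) :=
    Real.mul_self_sqrt (by positivity)
  rw [Fin.sum_univ_succ, kernelMatrix]
  congr 1
  rw [kernelCoeff, Fin.cons_zero, Fin.val_zero, coupled_zero, smul_smul,
    ← Complex.ofReal_mul, hsqrt]
  push_cast
  rfl

theorem sqrt_two_mul_add_one_div_pos (n i : ℕ) :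
    0 < Real.sqrt ((2 * ((i : ℝ) + 1) + 1) / (n + 1)) :=
  Real.sqrt_pos.2 (by positivity)

theorem kernelCoeff_ne_zero {n : ℕ} {c : Fin n → ℝ} (hc : ∀ i, c i ≠ 0) (l : Fin (n + 1)) :
    kernelCoeff n c l ≠ 0 := by
  refine Fin.cases ?_ (fun i => ?_) l
  · exact (Real.sqrt_pos.2 (by positivity)).ne'
  · exact mul_ne_zero (hc i) (sqrt_two_mul_add_one_div_pos n i).ne'

theorem trace_coupled_mul_kernelMatrix (n : ℕ) (c : Fin n → ℝ) (l : Fin (n + 1)) :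
    (coupled n l * kernelMatrix n c).trace = kernelCoeff n c l := by
  rw [kernelMatrix_eq_sum_coupled, trace_coupled_mul_sum_coupled]

theorem kernelMatrix_injective (n : ℕ) : Function.Injective (kernelMatrix n) := by
  intro c c' h
  ext i
  have hcoeff := trace_coupled_mul_kernelMatrix n c i.succ
  rw [h, trace_coupled_mul_kernelMatrix, Complex.ofReal_inj] at hcoeff
  exact (mul_right_cancel₀ (sqrt_two_mul_add_one_div_pos n i).ne' hcoeff).symm

theorem trace_kernelMatrix (n : ℕ) (c : Fin n → ℝ) : (kernelMatrix n c).trace = 1 := by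
  have hn : (n + 1 : ℂ) ≠ 0 := by exact_mod_cast Nat.succ_ne_zero n
  rw [kernelMatrix, Matrix.trace_add, Matrix.trace_sum, Finset.sum_eq_zero, add_zero,
    Matrix.trace_smul, Matrix.trace_one]
  · simp [hn]
  · intro i _
    rw [Matrix.trace_smul, trace_coupled (by omega), smul_zero]

theorem exists_kernelMatrix_eq_diagonal (n : ℕ) (c : Fin n → ℝ) :
    ∃ d : Fin (n + 1) → ℝ, kernelMatrix n c = Matrix.diagonal fun i => (d i : ℂ) :=
  ⟨_, (kernelMatrix_eq_sum_coupled n c).trans (sum_smul_coupled_eq_diagonal _)⟩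

/-! ### Rotations of the sphere -/

open scoped Pointwise in
theorem measurePreserving_toSphere_of_linearIsometryEquiv {E : Type*} [NormedAddCommGroup E]
    [InnerProductSpace ℝ E] [FiniteDimensional ℝ E] [MeasurableSpace E] [BorelSpace E]
    (L : E ≃ₗᵢ[ℝ] E) {f : Metric.sphere (0 : E) 1 → Metric.sphere (0 : E) 1}
    (hf : ∀ x, (f x : E) = L x) :
    MeasureTheory.MeasurePreserving f (MeasureTheory.volume : MeasureTheory.Measure E).toSphere
      (MeasureTheory.volume : MeasureTheory.Measure E).toSphere := by
  have hfc : Continuous f := by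
    rw [Topology.IsEmbedding.subtypeVal.continuous_iff, show Subtype.val ∘ f = _ from funext hf]
    exact L.continuous.comp continuous_subtype_val
  refine ⟨hfc.measurable, MeasureTheory.Measure.ext fun s hs => ?_⟩
  have hL (T : Set E) : MeasureTheory.volume (L ⁻¹' T) = MeasureTheory.volume T :=
    L.measurePreserving.measure_preimage_emb L.toHomeomorph.measurableEmbedding T
  have hcone : Set.Ioo (0 : ℝ) 1 • (Subtype.val '' (f ⁻¹' s)) =
      L ⁻¹' (Set.Ioo (0 : ℝ) 1 • (Subtype.val '' s)) := by
    ext y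
    simp only [Set.mem_smul, Set.mem_image, Set.mem_preimage]
    constructor
    · rintro ⟨r, hr, _, ⟨x, hx, rfl⟩, rfl⟩
      exact ⟨r, hr, _, ⟨f x, hx, rfl⟩, by rw [hf]; exact (L.map_smul r (x : E)).symm⟩
    · rintro ⟨r, hr, _, ⟨x, hx, rfl⟩, h⟩
      have hfx : f ⟨L.symm x, by simp⟩ = x := Subtype.ext (by rw [hf]; simp)
      exact ⟨r, hr, _, ⟨⟨L.symm x, by simp⟩, by rwa [hfx], rfl⟩,
        L.injective (by rw [map_smul]; simpa using h)⟩
  rw [MeasureTheory.Measure.map_apply hfc.measurable hs,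
    MeasureTheory.Measure.toSphere_apply' _ (hfc.measurable hs),
    MeasureTheory.Measure.toSphere_apply' _ hs, hcone, hL]

theorem pauli_injective : Function.Injective pauli := by
  intro x y h
  rw [pauli_eq, pauli_eq] at h
  have h10 := congrFun (congrFun h 1) 0
  have h00 := congrFun (congrFun h 0) 0
  simp only [Matrix.of_apply, Matrix.cons_val', Matrix.cons_val_zero, Matrix.cons_val_one,
    Matrix.cons_val_fin_one] at h10 h00
  ext i
  fin_cases i
  · simpa using congrArg Complex.re h10
  · simpa using congrArg Complex.im h10
  · exact Complex.ofReal_injective h00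

theorem pauli_add (x y : E3) : pauli (x + y) = pauli x + pauli y := by
  simp only [pauli, PiLp.add_apply, Complex.ofReal_add]
  module

theorem pauli_smul (r : ℝ) (x : E3) : pauli (r • x) = (r : ℂ) • pauli x := by
  simp only [pauli, PiLp.smul_apply, smul_eq_mul, Complex.ofReal_mul]
  module

theorem star_pauli (x : E3) : star (pauli x) = pauli x := by
  rw [pauli_eq]
  ext i j
  fin_cases i <;> fin_cases j <;> simp [Matrix.star_apply, sub_eq_add_neg]

theorem rotVec_mul (g h : SU2) (x : E3) : rotVec (g * h) x = rotVec g (rotVec h x) := by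
  apply pauli_injective
  simp only [pauli_rotVec, Submonoid.coe_mul, star_mul, mul_assoc]

theorem rotVec_one (x : E3) : rotVec 1 x = x := by
  apply pauli_injective
  simp only [pauli_rotVec, Submonoid.coe_one, star_one, one_mul, mul_one]

theorem rot_mul (g h : SU2) (x : S2) : rot (g * h) x = rot g (rot h x) :=
  Subtype.ext (rotVec_mul g h x.1)

theorem rot_one (x : S2) : rot 1 x = x := Subtype.ext (rotVec_one x.1)

theorem rot_inv_rot (g : SU2) (x : S2) : rot g⁻¹ (rot g x) = x := by
  rw [← rot_mul, inv_mul_cancel, rot_one]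

/-- The rotation `ψ(g)` as a linear isometry of `ℝ³`. -/
def rotIsometry (g : SU2) : E3 ≃ₗᵢ[ℝ] E3 where
  toFun := rotVec g
  invFun := rotVec g⁻¹
  left_inv x := by rw [← rotVec_mul, inv_mul_cancel, rotVec_one]
  right_inv x := by rw [← rotVec_mul, mul_inv_cancel, rotVec_one]
  map_add' x y := by
    apply pauli_injective
    simp only [pauli_rotVec, pauli_add, mul_add, add_mul]
  map_smul' r x := by
    apply pauli_injective
    simp only [pauli_rotVec, pauli_smul, mul_smul_comm, smul_mul_assoc, RingHom.id_apply]
  norm_map' := norm_rotVec g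

theorem continuous_rot (g : SU2) : Continuous (rot g) :=
  ((rotIsometry g).continuous.comp continuous_subtype_val).subtype_mk _

/-- The homeomorphism of `S²` given by `g ∈ SU(2)`. -/
def rotHomeo (g : SU2) : S2 ≃ₜ S2 where
  toFun := rot g
  invFun := rot g⁻¹
  left_inv := rot_inv_rot g
  right_inv x := by rw [← rot_mul, mul_inv_cancel, rot_one]
  continuous_toFun := continuous_rot g
  continuous_invFun := continuous_rot g⁻¹

theorem integral_comp_rot {F : Type*} [NormedAddCommGroup F] [NormedSpace ℝ F] (g : SU2)
    (f : S2 → F) :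
    ∫ x, f (rot g x) ∂(MeasureTheory.volume : MeasureTheory.Measure E3).toSphere =
      ∫ x, f x ∂(MeasureTheory.volume : MeasureTheory.Measure E3).toSphere :=
  (measurePreserving_toSphere_of_linearIsometryEquiv (rotIsometry g) fun _ => rfl).integral_comp
    (rotHomeo g).measurableEmbedding f

theorem toSphere_real_univ :
    (MeasureTheory.volume : MeasureTheory.Measure E3).toSphere.real Set.univ = 4 * Real.pi := by
  rw [MeasureTheory.Measure.toSphere_real_apply_univ, MeasureTheory.measureReal_def,
    EuclideanSpace.volume_ball_fin_three]
  have : 0 ≤ Real.pi * 4 / 3 := by positivity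
  simp [ENNReal.toReal_ofReal this]
  ring

theorem coord_sq_sum (x : S2) : x.1 0 ^ 2 + x.1 1 ^ 2 + x.1 2 ^ 2 = 1 := by
  have h : ‖x.1‖ ^ 2 = 1 := by simp
  rw [EuclideanSpace.norm_sq_eq] at h
  simpa [Fin.sum_univ_three] using h

theorem mem_specialUnitaryGroup_of_normSq_add {a b : ℂ}
    (h : Complex.normSq a + Complex.normSq b = 1) :
    !![a, -star b; b, star a] ∈ Matrix.specialUnitaryGroup (Fin 2) ℂ := by
  have h' : a * star a + b * star b = 1 := by
    rw [Complex.star_def, Complex.mul_conj, Complex.mul_conj]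
    exact_mod_cast h
  rw [Matrix.mem_specialUnitaryGroup_iff, Matrix.mem_unitaryGroup_iff]
  constructor
  · ext i j
    fin_cases i <;> fin_cases j <;>
      simp [Matrix.mul_apply, Fin.sum_univ_two, Matrix.star_apply] at h' ⊢
    · linear_combination h'
    · ring
    · ring
    · linear_combination h'
  · rw [Matrix.det_fin_two_of]
    linear_combination h'

theorem exists_spinor (x : S2) : ∃ a b : ℂ, Complex.normSq a + Complex.normSq b = 1 ∧
    ((x.1 2 : ℝ) : ℂ) = a * star a - b * star b ∧
    ((x.1 0 : ℝ) : ℂ) + (x.1 1 : ℝ) * Complex.I = 2 * b * star a := by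
  have hx := coord_sq_sum x
  have h₁ : 0 ≤ (1 + x.1 2) / 2 := by nlinarith [sq_nonneg (x.1 0), sq_nonneg (x.1 1)]
  have h₂ : 0 ≤ (1 - x.1 2) / 2 := by nlinarith [sq_nonneg (x.1 0), sq_nonneg (x.1 1)]
  set w : ℂ := ⟨x.1 0, x.1 1⟩ with hw
  have hnorm : ‖w‖ = 2 * Real.sqrt ((1 - x.1 2) / 2) * Real.sqrt ((1 + x.1 2) / 2) := by
    rw [← sq_eq_sq₀ (norm_nonneg _) (by positivity), mul_pow, mul_pow, Real.sq_sqrt h₁,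
      Real.sq_sqrt h₂, Complex.sq_norm, hw, Complex.normSq_mk]
    linear_combination hx
  let a : ℂ := Real.sqrt ((1 + x.1 2) / 2)
  let b : ℂ := Real.sqrt ((1 - x.1 2) / 2) * Complex.exp (w.arg * Complex.I)
  have ha : Complex.normSq a = (1 + x.1 2) / 2 := by
    rw [Complex.normSq_ofReal, Real.mul_self_sqrt h₁]
  have hb : Complex.normSq b = (1 - x.1 2) / 2 := by
    rw [map_mul, Complex.normSq_ofReal, Real.mul_self_sqrt h₂, Complex.normSq_eq_norm_sq,
      Complex.norm_exp_ofReal_mul_I, one_pow, mul_one]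
  refine ⟨a, b, by rw [ha, hb]; ring, ?_, ?_⟩
  · rw [Complex.star_def, Complex.mul_conj, Complex.mul_conj, ha, hb]
    push_cast
    ring
  · calc ((x.1 0 : ℝ) : ℂ) + (x.1 1 : ℝ) * Complex.I = w := (Complex.mk_eq_add_mul_I _ _).symm
      _ = ‖w‖ * Complex.exp (w.arg * Complex.I) := (Complex.norm_mul_exp_arg_mul_I w).symm
      _ = 2 * b * star a := by
        rw [hnorm, Complex.star_def, Complex.conj_ofReal]
        push_cast
        ring

theorem exists_rot_northPole (x : S2) : ∃ g : SU2, rot g northPole = x := by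
  obtain ⟨a, b, hab, h₂, h₀₁⟩ := exists_spinor x
  refine ⟨⟨_, mem_specialUnitaryGroup_of_normSq_add hab⟩, Subtype.ext (pauli_injective ?_)⟩
  have h₁₀ : ((x.1 0 : ℝ) : ℂ) - (x.1 1 : ℝ) * Complex.I = 2 * a * star b := by
    have h := congrArg star h₀₁
    simp only [star_add, star_mul', Complex.star_def, Complex.conj_ofReal, Complex.conj_I,
      Complex.conj_conj, map_ofNat] at h ⊢
    linear_combination h
  change pauli (rotVec _ northPole.1) = _
  rw [pauli_rotVec, pauli_eq, pauli_eq, h₂, h₀₁, h₁₀]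
  ext i j
  fin_cases i <;> fin_cases j <;>
    simp [northPole, Matrix.mul_apply, Fin.sum_univ_two, Matrix.star_apply] <;> ring

/-- The one-parameter subgroup `exp(i t x·σ)` of `SU(2)`. -/
def circle (x : S2) (t : ℝ) : SU2 :=
  ⟨(Real.cos t : ℂ) • 1 + (Real.sin t * Complex.I : ℂ) • pauli x.1, by
    have h : (Real.cos t : ℂ) • 1 + (Real.sin t * Complex.I : ℂ) • pauli x.1 =
        !![(⟨Real.cos t, Real.sin t * x.1 2⟩ : ℂ),
          -star (⟨-(Real.sin t * x.1 1), Real.sin t * x.1 0⟩ : ℂ);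
          (⟨-(Real.sin t * x.1 1), Real.sin t * x.1 0⟩ : ℂ),
          star (⟨Real.cos t, Real.sin t * x.1 2⟩ : ℂ)] := by
      rw [pauli_eq]
      ext i j
      fin_cases i <;> fin_cases j <;> apply Complex.ext <;>
        simp [Complex.cos_ofReal_re, Complex.sin_ofReal_re]
    rw [h]
    apply mem_specialUnitaryGroup_of_normSq_add
    rw [Complex.normSq_mk, Complex.normSq_mk]
    linear_combination Real.cos_sq_add_sin_sq t + Real.sin t ^ 2 * coord_sq_sum x⟩

theorem coe_circle (x : S2) (t : ℝ) : (circle x t : Matrix (Fin 2) (Fin 2) ℂ) =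
    (Real.cos t : ℂ) • 1 + (Real.sin t * Complex.I : ℂ) • pauli x.1 := rfl

theorem circle_inv (x : S2) (t : ℝ) : (circle x t)⁻¹ = circle x (-t) := by
  apply Subtype.ext
  rw [← Matrix.star_eq_inv]
  change star (circle x t).1 = _
  rw [coe_circle, coe_circle, star_add, star_smul, star_smul, star_pauli, star_one,
    star_mul', Complex.star_def, Complex.conj_ofReal, Complex.conj_ofReal, Complex.conj_I,
    Real.cos_neg, Real.sin_neg, Complex.ofReal_neg, neg_mul, mul_neg]

theorem circle_zero (x : S2) : circle x 0 = 1 := Subtype.ext (by simp [coe_circle])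

theorem hasDerivAt_circle_mulVec (x : S2) (w : Fin 2 → ℂ) :
    HasDerivAt (fun t => (circle x t).1 *ᵥ w) ((Complex.I • pauli x.1) *ᵥ w) 0 := by
  have hcos := ((Real.hasDerivAt_cos 0).ofReal_comp.smul_const w)
  have hsin := ((Real.hasDerivAt_sin 0).ofReal_comp.mul_const Complex.I).smul_const (pauli x.1 *ᵥ w)
  simpa [coe_circle, Matrix.add_mulVec, Matrix.smul_mulVec] using hcos.fun_add hsin

section

open scoped Matrix.Norms.Operator

theorem hasDerivAt_of_mulVec {m : ℕ} {M : ℝ → Op m} {M' : Op m} {t : ℝ}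
    (h : ∀ v, HasDerivAt (fun s => M s *ᵥ v) (M' *ᵥ v) t) : HasDerivAt M M' t := by
  refine hasDerivAt_pi.2 fun k => hasDerivAt_pi.2 fun i => ?_
  simpa using hasDerivAt_pi.1 (h (Pi.single i 1)) k

theorem hasDerivAt_spinRep_circle (n : ℕ) (x : S2) :
    HasDerivAt (fun t => spinRep n (circle x t)) (dspin n (Complex.I • pauli x.1)) 0 := by
  refine hasDerivAt_of_mulVec fun v => ?_
  have h := hasDerivAt_spinMatrix_mulVec n (γ := fun t => (circle x t).1) (t := 0)
    (X := Complex.I • pauli x.1)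
    (fun w => by simpa [circle_zero] using hasDerivAt_circle_mulVec x w) v
  simpa [spinRep_apply, circle_zero, spinMatrix_one] using h

theorem hasDerivAt_opAct_circle (n : ℕ) (x : S2) (A : Op n) :
    HasDerivAt (fun t => opAct n (circle x t) A) ⁅dspin n (Complex.I • pauli x.1), A⁆ 0 := by
  have hinv := HasDerivAt.scomp_of_eq (0 : ℝ) (hasDerivAt_spinRep_circle n x) (hasDerivAt_neg 0)
    neg_zero.symm
  have h := ((hasDerivAt_spinRep_circle n x).mul_const A).fun_mul hinv
  simp only [opAct, circle_inv]
  refine h.congr_deriv ?_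
  simp [circle_zero, Ring.lie_def, sub_eq_add_neg]

theorem lie_dspin_mem {n : ℕ} {Q : Submodule ℂ (Op n)} {A : Op n} {x : S2}
    (h : ∀ t, opAct n (circle x t) A - A ∈ Q) : ⁅dspin n (Complex.I • pauli x.1), A⁆ ∈ Q := by
  have hlim := hasDerivAt_iff_tendsto_slope.1 (hasDerivAt_opAct_circle n x A)
  refine Q.closed_of_finiteDimensional.mem_of_tendsto hlim (.of_forall fun t => ?_)
  rw [slope_def_module, circle_zero]
  simpa [opAct] using (Q.restrictScalars ℝ).smul_mem (t - 0)⁻¹ (h t)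

end

theorem lie_Jplus_Jminus_mem {n : ℕ} {Q : Submodule ℂ (Op n)} {A : Op n}
    (h : ∀ g, opAct n g A - A ∈ Q) : ⁅Jplus n, A⁆ ∈ Q ∧ ⁅Jminus n, A⁆ ∈ Q := by
  have haxis (i : Fin 3) : ⁅dspin n (Complex.I • pauli (EuclideanSpace.single i 1)), A⁆ ∈ Q :=
    lie_dspin_mem (x := ⟨EuclideanSpace.single i 1, by simp⟩) fun t => h _
  have h₀ : dspin n (Complex.I • pauli (EuclideanSpace.single 0 1)) =
      Complex.I • (Jplus n + Jminus n) := by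
    simp [dspin, pauli_eq]
  have h₁ : dspin n (Complex.I • pauli (EuclideanSpace.single 1 1)) = Jplus n - Jminus n := by
    simp [dspin, pauli_eq, sub_eq_add_neg]
  have hadd := haxis 0
  have hsub := haxis 1
  rw [h₀, smul_lie, Submodule.smul_mem_iff _ Complex.I_ne_zero, add_lie] at hadd
  rw [h₁, sub_lie] at hsub
  constructor
  · rw [← Submodule.smul_mem_iff _ (two_ne_zero (α := ℂ))]
    convert Q.add_mem hadd hsub using 1
    module
  · rw [← Submodule.smul_mem_iff _ (two_ne_zero (α := ℂ))]
    convert Q.sub_mem hadd hsub using 1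
    module

/-! ### Invariance under the group -/

theorem opAct_mul (n : ℕ) (g h : SU2) (A : Op n) : opAct n (g * h) A = opAct n g (opAct n h A) := by
  simp only [opAct, mul_inv_rev, map_mul, mul_assoc]

theorem opAct_one (n : ℕ) (A : Op n) : opAct n 1 A = A := by
  rw [opAct, inv_one, map_one, one_mul, mul_one]

theorem trace_opAct_mul (n : ℕ) (g : SU2) (A B : Op n) :
    (opAct n g A * B).trace = (A * opAct n g⁻¹ B).trace := by
  rw [opAct, opAct, inv_inv, mul_assoc, mul_assoc, Matrix.trace_mul_comm, mul_assoc, mul_assoc]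

theorem trace_opAct (n : ℕ) (g : SU2) (A : Op n) : (opAct n g A).trace = A.trace := by
  rw [opAct, Matrix.trace_mul_comm, ← mul_assoc, spinRep_inv_mul, one_mul]

theorem eq_smul_one_of_opAct_eq {n : ℕ} {A : Op n} (h : ∀ g, opAct n g A = A) :
    ∃ c : ℂ, A = c • 1 := by
  have hlie := lie_Jplus_Jminus_mem (Q := ⊥) (A := A) fun g => by
    rw [h, sub_self]
    exact zero_mem _
  exact eq_smul_one_of_lie_eq_zero ((Submodule.mem_bot ℂ).1 hlie.1) ((Submodule.mem_bot ℂ).1 hlie.2)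

theorem exists_eq_trace_mul {R ι : Type*} [CommSemiring R] [Fintype ι]
    (f : Matrix ι ι R →ₗ[R] R) : ∃ K : Matrix ι ι R, ∀ P, f P = (P * K).trace := by
  classical
  refine ⟨Matrix.of fun i k => f (Matrix.single k i 1), fun P => ?_⟩
  conv_lhs => rw [Matrix.matrix_eq_sum_single P]
  simp only [map_sum, Matrix.trace, Matrix.diag_apply, Matrix.mul_apply, Matrix.of_apply]
  refine Finset.sum_congr rfl fun k _ => Finset.sum_congr rfl fun i _ => ?_
  rw [← smul_eq_mul, ← map_smul, Matrix.smul_single, smul_eq_mul, mul_one]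

theorem exists_eq_mul_trace_of_opAct_eq {n : ℕ} {f : Op n →ₗ[ℂ] ℂ}
    (h : ∀ g P, f (opAct n g P) = f P) : ∃ c : ℂ, ∀ P, f P = c * P.trace := by
  obtain ⟨M, hM⟩ := exists_eq_trace_mul f
  obtain ⟨c, rfl⟩ : ∃ c : ℂ, M = c • 1 := eq_smul_one_of_opAct_eq fun g => by
    refine Matrix.ext_iff_trace_mul_left.2 fun P => ?_
    rw [← hM, ← h g⁻¹, hM, trace_opAct_mul, inv_inv]
  refine ⟨c, fun P => ?_⟩
  rw [hM, mul_smul_comm, mul_one, Matrix.trace_smul, smul_eq_mul]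

/-- The operators that are orthogonal to the orbit of `K`, with respect to the trace form. -/
def orbitAnnihilator (n : ℕ) (K : Op n) : Submodule ℂ (Op n) where
  carrier := {P | ∀ g : SU2, (P * opAct n g K).trace = 0}
  zero_mem' g := by rw [zero_mul, Matrix.trace_zero]
  add_mem' {P P'} hP hP' g := by
    rw [add_mul, Matrix.trace_add, hP g, hP' g, add_zero]
  smul_mem' c P hP g := by
    rw [smul_mul_assoc, Matrix.trace_smul, hP g, smul_zero]

theorem opAct_mem_orbitAnnihilator {n : ℕ} {K P : Op n} (hP : P ∈ orbitAnnihilator n K) (g : SU2) :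
    opAct n g P ∈ orbitAnnihilator n K := fun h => by
  rw [trace_opAct_mul, ← opAct_mul]
  exact hP _

theorem orbitAnnihilator_kernelMatrix {n : ℕ} {c : Fin n → ℝ} (hc : ∀ i, c i ≠ 0) :
    orbitAnnihilator n (kernelMatrix n c) = ⊥ := by
  by_contra hne
  have hlie := fun P (hP : P ∈ orbitAnnihilator n (kernelMatrix n c)) =>
    lie_Jplus_Jminus_mem fun g => sub_mem (opAct_mem_orbitAnnihilator hP g) hP
  obtain ⟨l, hl, hmem⟩ :=
    exists_coupled_mem hne (fun P hP => (hlie P hP).1) (fun P hP => (hlie P hP).2)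
  have hcoeff := trace_coupled_mul_kernelMatrix n c ⟨l, Nat.lt_succ_of_le hl⟩
  have hzero := hmem 1
  rw [opAct_one] at hzero
  rw [hzero, eq_comm, Complex.ofReal_eq_zero] at hcoeff
  exact kernelCoeff_ne_zero hc _ hcoeff

/-! ### Polynomials in the spin vector -/

/-- The operator `x · J = x₁ J₁ + x₂ J₂ + x₃ J₃`. -/
def spinVec (n : ℕ) (x : E3) : Op n := dspin n ((1 / 2 : ℂ) • pauli x)

theorem spinVec_eq (n : ℕ) (x : E3) : spinVec n x = ((x 2 : ℝ) : ℂ) • Jz n +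
    (((x 0 : ℝ) - (x 1 : ℝ) * Complex.I) / 2 : ℂ) • Jplus n +
    (((x 0 : ℝ) + (x 1 : ℝ) * Complex.I) / 2 : ℂ) • Jminus n := by
  simp only [spinVec, dspin, pauli_eq, Matrix.smul_apply, Matrix.of_apply, Matrix.cons_val',
    Matrix.cons_val_zero, Matrix.cons_val_one, Matrix.cons_val_fin_one, smul_eq_mul]
  module

theorem spinVec_northPole (n : ℕ) : spinVec n northPole.1 = Jz n := by
  simp [spinVec_eq, northPole]

theorem spinVec_isSelfAdjoint (n : ℕ) (x : E3) : IsSelfAdjoint (spinVec n x) := by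
  rw [isSelfAdjoint_iff, Matrix.star_eq_conjTranspose, spinVec_eq]
  simp only [Matrix.conjTranspose_add, Matrix.conjTranspose_smul, Jz_conjTranspose,
    Jplus_conjTranspose, Jminus_conjTranspose]
  simp [sub_eq_add_neg]
  abel

theorem SU2.star_mul_self (g : SU2) : star g.1 * g.1 = 1 :=
  Matrix.mem_unitaryGroup_iff'.1 (Matrix.mem_specialUnitaryGroup_iff.1 g.2).1

theorem semiconjBy_spinVec (n : ℕ) (g : SU2) (x : E3) :
    SemiconjBy (spinRep n g) (spinVec n x) (spinVec n (rotVec g x)) := by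
  refine spinMatrix_mul_dspin n ?_
  rw [pauli_rotVec, mul_smul_comm, smul_mul_assoc, mul_assoc, g.star_mul_self, mul_one]

theorem semiconjBy_aeval {R A : Type*} [CommSemiring R] [Semiring A] [Algebra R A] {s a b : A}
    (h : SemiconjBy s a b) (p : R[X]) : SemiconjBy s (aeval a p) (aeval b p) := by
  rw [SemiconjBy, aeval_eq_sum_range, aeval_eq_sum_range, Finset.mul_sum, Finset.sum_mul]
  refine Finset.sum_congr rfl fun i _ => ?_
  rw [mul_smul_comm, smul_mul_assoc, (h.pow_right i).eq]

theorem opAct_aeval_spinVec (n : ℕ) (p : ℝ[X]) (g : SU2) (x : E3) :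
    opAct n g (aeval (spinVec n x) p) = aeval (spinVec n (rotVec g x)) p :=
  opAct_eq_of_semiconjBy (semiconjBy_aeval (semiconjBy_spinVec n g x) p)

theorem isSelfAdjoint_aeval {R A : Type*} [CommSemiring R] [StarRing R] [TrivialStar R]
    [Semiring A] [StarRing A] [Algebra R A] [StarModule R A] {a : A} (ha : IsSelfAdjoint a)
    (p : R[X]) : IsSelfAdjoint (aeval a p) := by
  rw [aeval_eq_sum_range]
  exact isSelfAdjoint_sum _ fun i _ => (IsSelfAdjoint.all _).smul (ha.pow i)

theorem aeval_diagonal {R S ι : Type*} [CommSemiring R] [CommSemiring S] [Algebra R S] [Fintype ι]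
    [DecidableEq ι] (d : ι → S) (p : R[X]) :
    aeval (Matrix.diagonal d) p = Matrix.diagonal fun i => aeval (d i) p := by
  change aeval (Matrix.diagonalAlgHom R d) p = _
  rw [aeval_algHom_apply]
  change Matrix.diagonal _ = _
  congr 1
  ext i
  exact (aeval_algHom_apply (Pi.evalAlgHom R (fun _ => S) i) d p).symm

theorem exists_aeval_Jz_eq_diagonal (n : ℕ) (d : Fin (n + 1) → ℝ) :
    ∃ p : ℝ[X], aeval (Jz n) p = Matrix.diagonal fun i => (d i : ℂ) := by
  let v : Fin (n + 1) → ℝ := fun i => (n : ℝ) / 2 - (i : ℕ)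
  have hv : Function.Injective v := fun i j hij => Fin.ext (by simpa [v] using hij)
  have hJz : Jz n = Matrix.diagonal fun i => (v i : ℂ) := by simp [Jz, v]
  refine ⟨Lagrange.interpolate Finset.univ v d, ?_⟩
  rw [hJz, aeval_diagonal]
  congr! with i
  rw [← Lagrange.eval_interpolate_at_node d hv.injOn (Finset.mem_univ i)]
  exact aeval_algebraMap_apply_eq_algebraMap_eval _ _

/-- The linear map that takes `P` to the function `x ↦ trace (P p(x·J))` on the sphere. -/
def polySymbol (n : ℕ) (p : ℝ[X]) : Op n →ₗ[ℂ] (S2 → ℂ) :=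
  LinearMap.pi fun x =>
    Matrix.traceLinearMap _ ℂ ℂ ∘ₗ LinearMap.mulRight ℂ (aeval (spinVec n x.1) p)

theorem polySymbol_apply (n : ℕ) (p : ℝ[X]) (P : Op n) (x : S2) :
    polySymbol n p P x = (P * aeval (spinVec n x.1) p).trace := rfl

theorem isGivenBy_polySymbol (n : ℕ) (p : ℝ[X]) :
    IsGivenBy n (polySymbol n p) (aeval (Jz n) p) := by
  intro P g
  rw [polySymbol_apply, ← spinVec_northPole, opAct_aeval_spinVec]
  rfl

theorem polySymbol_conjTranspose (n : ℕ) (p : ℝ[X]) (P : Op n) (x : S2) :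
    polySymbol n p Pᴴ x = star (polySymbol n p P x) := by
  have hp : (aeval (spinVec n x.1) p)ᴴ = aeval (spinVec n x.1) p :=
    isSelfAdjoint_aeval (spinVec_isSelfAdjoint n x.1) p
  rw [polySymbol_apply, polySymbol_apply, ← Matrix.trace_conjTranspose, Matrix.conjTranspose_mul,
    hp, Matrix.trace_mul_comm]

section

open scoped Matrix.Norms.Operator

theorem contDiff_spinVec (n : ℕ) : ContDiff ℝ ∞ (spinVec n) := by
  have h (j : Fin 3) : ContDiff ℝ ∞ fun x : E3 => ((x j : ℝ) : ℂ) :=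
    Complex.ofRealCLM.contDiff.comp (EuclideanSpace.proj (𝕜 := ℝ) j).contDiff
  have := h 0
  have := h 1
  have := h 2
  simp only [funext (spinVec_eq n), div_eq_mul_inv]
  fun_prop

theorem contMDiff_polySymbol (n : ℕ) (p : ℝ[X]) (P : Op n) :
    ContMDiff (𝓡 2) 𝓘(ℝ, ℂ) ∞ (polySymbol n p P) := by
  have haeval : ContDiff ℝ ∞ fun x : E3 => aeval (spinVec n x) p := by
    simp only [aeval_eq_sum_range]
    exact ContDiff.sum fun i _ => ((contDiff_spinVec n).pow i).const_smul _
  let f := (Matrix.traceLinearMap _ ℝ ℂ ∘ₗ LinearMap.mulLeft ℝ P).toContinuousLinearMap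
  exact (f.contDiff.comp haeval).contMDiff.comp contMDiff_coe_sphere

end

/-! ### Symbol maps given by a kernel -/

section IsGivenBy

variable {n : ℕ} {W W' : Op n →ₗ[ℂ] (S2 → ℂ)} {K K' : Op n}

theorem IsGivenBy.apply_northPole (h : IsGivenBy n W K) (P : Op n) :
    W P northPole = (P * K).trace := by
  simpa only [rot_one, opAct_one] using h P 1

theorem IsGivenBy.apply_one (h : IsGivenBy n W K) (x : S2) : W 1 x = K.trace := by
  obtain ⟨g, rfl⟩ := exists_rot_northPole x
  rw [h, one_mul, trace_opAct]

theorem IsGivenBy.equivariant (h : IsGivenBy n W K) (g : SU2) (P : Op n) (x : S2) :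
    W (opAct n g P) x = W P (rot g⁻¹ x) := by
  obtain ⟨k, rfl⟩ := exists_rot_northPole x
  rw [h, ← rot_mul, h, trace_opAct_mul, opAct_mul]

theorem isGivenBy_of_equivariant (hW : ∀ g P x, W (opAct n g P) x = W P (rot g⁻¹ x))
    (h : ∀ P, W P northPole = (P * K).trace) : IsGivenBy n W K := by
  intro P g
  rw [← inv_inv g, ← hW, h, trace_opAct_mul]

theorem IsGivenBy.unique (h : IsGivenBy n W K) (h' : IsGivenBy n W' K) : W = W' := by
  ext P x
  obtain ⟨g, rfl⟩ := exists_rot_northPole x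
  rw [h, h']

theorem IsGivenBy.kernel_unique (h : IsGivenBy n W K) (h' : IsGivenBy n W K') : K = K' :=
  Matrix.ext_iff_trace_mul_left.2 fun P => by rw [← h.apply_northPole, h'.apply_northPole]

theorem IsGivenBy.injective_iff (h : IsGivenBy n W K) :
    Function.Injective W ↔ orbitAnnihilator n K = ⊥ := by
  suffices hker : LinearMap.ker W = orbitAnnihilator n K by rw [← hker, LinearMap.ker_eq_bot]
  ext P
  refine ⟨fun hP g => ?_, fun hP => funext fun x => ?_⟩
  · rw [← h, LinearMap.mem_ker.1 hP, Pi.zero_apply]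
  · obtain ⟨g, rfl⟩ := exists_rot_northPole x
    rw [h, hP g, Pi.zero_apply]

theorem IsGivenBy.average_eq (h : IsGivenBy n W K) (hcont : ∀ P, Continuous (W P)) (P : Op n) :
    (1 / (4 * Real.pi) : ℂ) * ∫ x, W P x ∂(MeasureTheory.volume : MeasureTheory.Measure E3).toSphere
      = (1 / (n + 1) : ℂ) * K.trace * P.trace := by
  let μ := (MeasureTheory.volume : MeasureTheory.Measure E3).toSphere
  have hint (P : Op n) : MeasureTheory.Integrable (W P) μ :=
    (hcont P).integrable_of_hasCompactSupport (HasCompactSupport.of_compactSpace _)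
  let f : Op n →ₗ[ℂ] ℂ :=
    { toFun P := ∫ x, W P x ∂μ
      map_add' P Q := by
        rw [map_add]
        exact MeasureTheory.integral_add (hint P) (hint Q)
      map_smul' c P := by
        rw [map_smul]
        exact MeasureTheory.integral_smul c (W P) }
  obtain ⟨c, hc⟩ := exists_eq_mul_trace_of_opAct_eq (f := f) fun g P => by
    change ∫ x, W (opAct n g P) x ∂μ = ∫ x, W P x ∂μ
    simp only [h.equivariant]
    exact integral_comp_rot g⁻¹ (W P)
  have hone : 4 * Real.pi * K.trace = c * (n + 1) := by
    have hf : f 1 = 4 * Real.pi * K.trace := by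
      change ∫ x, W 1 x ∂μ = _
      simp only [h.apply_one, MeasureTheory.integral_const, μ, toSphere_real_univ,
        Complex.real_smul]
      push_cast
      rfl
    rw [← hf, hc, Matrix.trace_one, Fintype.card_fin]
    push_cast
    rfl
  have hn : (n + 1 : ℂ) ≠ 0 := by exact_mod_cast Nat.succ_ne_zero n
  have hpi : (Real.pi : ℂ) ≠ 0 := by exact_mod_cast Real.pi_ne_zero
  rw [show ∫ x, W P x ∂μ = c * P.trace from hc P]
  field_simp
  linear_combination -P.trace * hone

theorem rot_circle_northPole (t : ℝ) : rot (circle northPole t) northPole = northPole := by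
  refine Subtype.ext (pauli_injective ?_)
  have hcomm : Commute (circle northPole t).1 (pauli northPole.1) := by
    rw [coe_circle]
    exact ((Commute.one_left _).smul_left _).add_left ((Commute.refl _).smul_left _)
  have hunitary : (circle northPole t).1 * star (circle northPole t).1 = 1 :=
    mul_eq_one_comm.1 (circle northPole t).star_mul_self
  change pauli (rotVec _ northPole.1) = _
  rw [pauli_rotVec, hcomm.eq, mul_assoc, hunitary, mul_one]

theorem IsGivenBy.opAct_circle (h : IsGivenBy n W K) (t : ℝ) :
    opAct n (circle northPole t) K = K :=
  Matrix.ext_iff_trace_mul_left.2 fun P => by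
    rw [← h P, rot_circle_northPole, h.apply_northPole]

theorem IsGivenBy.Jz_lie_eq_zero (h : IsGivenBy n W K) : ⁅Jz n, K⁆ = 0 := by
  have hmem := lie_dspin_mem (Q := ⊥) (A := K) (x := northPole) fun t => by
    rw [h.opAct_circle, sub_self]
    exact zero_mem _
  have hJz : dspin n (Complex.I • pauli northPole.1) = (2 * Complex.I) • Jz n := by
    simp [dspin, pauli_eq, northPole, two_mul]
  rw [hJz, smul_lie, Submodule.mem_bot] at hmem
  exact (smul_eq_zero.1 hmem).resolve_left (by simp)

theorem IsGivenBy.coeff_ne_zero {κ : Fin (n + 1) → ℂ}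
    (h : IsGivenBy n W (∑ l : Fin (n + 1), κ l • coupled n l)) (hW : Function.Injective W)
    (l : Fin (n + 1)) : κ l ≠ 0 := by
  intro hκ
  have hmem : coupled n l ∈ orbitAnnihilator n (∑ l : Fin (n + 1), κ l • coupled n l) := by
    intro g
    rw [← opActLin_apply, map_sum, Finset.mul_sum, Matrix.trace_sum]
    refine Finset.sum_eq_zero fun l' _ => ?_
    rw [map_smul, mul_smul_comm, Matrix.trace_smul, opActLin_apply]
    rcases eq_or_ne l l' with rfl | hl
    · rw [hκ, zero_smul]
    · rw [trace_coupled_mul_opAct_coupled (mt Fin.ext hl), smul_zero]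
  rw [h.injective_iff.1 hW, Submodule.mem_bot] at hmem
  simpa [hmem] using trace_coupled_mul_self (Nat.lt_succ_iff.1 l.2)

end IsGivenBy

/-! ### The kernel of a symbol correspondence -/

section IsSymbolCorrespondence

variable {n : ℕ} {W : Op n →ₗ[ℂ] (S2 → ℂ)} {K : Op n}

theorem exists_isSymbolCorrespondence {c : Fin n → ℝ} (hc : ∀ i, c i ≠ 0) :
    ∃ W : Op n →ₗ[ℂ] (S2 → ℂ), IsSymbolCorrespondence n W ∧ IsGivenBy n W (kernelMatrix n c) := by
  obtain ⟨d, hd⟩ := exists_kernelMatrix_eq_diagonal n c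
  obtain ⟨p, hp⟩ := exists_aeval_Jz_eq_diagonal n d
  have hgiven : IsGivenBy n (polySymbol n p) (kernelMatrix n c) := by
    rw [hd, ← hp]
    exact isGivenBy_polySymbol n p
  refine ⟨polySymbol n p, ?_, hgiven⟩
  exact
    { smooth := contMDiff_polySymbol n p
      injective := hgiven.injective_iff.2 (orbitAnnihilator_kernelMatrix hc)
      equivariant := hgiven.equivariant
      real := polySymbol_conjTranspose n p
      normalized P := by
        rw [hgiven.average_eq (fun P => (contMDiff_polySymbol n p P).continuous),
          trace_kernelMatrix, mul_one] }

theorem IsSymbolCorrespondence.exists_isGivenBy (hW : IsSymbolCorrespondence n W) :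
    ∃ K : Op n, IsGivenBy n W K := by
  obtain ⟨K, hK⟩ := exists_eq_trace_mul (LinearMap.proj northPole ∘ₗ W)
  exact ⟨K, isGivenBy_of_equivariant hW.equivariant hK⟩

theorem IsSymbolCorrespondence.kernel_conjTranspose (hW : IsSymbolCorrespondence n W)
    (h : IsGivenBy n W K) : Kᴴ = K := by
  refine Matrix.ext_iff_trace_mul_left.2 fun P => ?_
  have hreal := hW.real Pᴴ northPole
  rw [h.apply_northPole, h.apply_northPole, Matrix.conjTranspose_conjTranspose,
    ← Matrix.trace_conjTranspose, Matrix.conjTranspose_mul, Matrix.conjTranspose_conjTranspose,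
    Matrix.trace_mul_comm Kᴴ] at hreal
  exact hreal.symm

theorem IsSymbolCorrespondence.kernel_trace (hW : IsSymbolCorrespondence n W)
    (h : IsGivenBy n W K) : K.trace = 1 := by
  have hn : (n + 1 : ℂ) ≠ 0 := by exact_mod_cast Nat.succ_ne_zero n
  have havg := (h.average_eq (fun P => (hW.smooth P).continuous) 1).symm.trans (hW.normalized 1)
  rw [Matrix.trace_one, Fintype.card_fin] at havg
  push_cast at havg
  field_simp at havg
  exact havg

theorem IsSymbolCorrespondence.exists_kernel_eq_sum_coupled (hW : IsSymbolCorrespondence n W)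
    (h : IsGivenBy n W K) :
    ∃ κ : Fin (n + 1) → ℝ, K = ∑ l : Fin (n + 1), (κ l : ℂ) • coupled n l := by
  have hdiag : K = Matrix.diagonal fun i => (((K i i).re : ℝ) : ℂ) := by
    ext k i
    rcases eq_or_ne k i with rfl | hki
    · rw [Matrix.diagonal_apply_eq]
      exact (Complex.conj_eq_iff_re.1 (congrFun₂ (hW.kernel_conjTranspose h) k k)).symm
    · rw [Matrix.diagonal_apply_ne _ hki, apply_eq_zero_of_Jz_lie_eq_zero h.Jz_lie_eq_zero hki]
  rw [hdiag]
  exact exists_diagonal_eq_sum_coupled _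

theorem exists_kernelMatrix_eq_sum_coupled {κ : Fin (n + 1) → ℝ}
    (h₀ : κ 0 = Real.sqrt (1 / (n + 1))) (hκ : ∀ l, κ l ≠ 0) : ∃ c : Fin n → ℝ, (∀ i, c i ≠ 0) ∧
      kernelMatrix n c = ∑ l : Fin (n + 1), (κ l : ℂ) • coupled n l := by
  refine ⟨fun i => κ i.succ / Real.sqrt ((2 * ((i : ℕ) + 1) + 1) / (n + 1)),
    fun i => div_ne_zero (hκ _) (sqrt_two_mul_add_one_div_pos n i).ne', ?_⟩
  rw [kernelMatrix_eq_sum_coupled]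
  have hcoeff : kernelCoeff n
      (fun i => κ i.succ / Real.sqrt ((2 * ((i : ℕ) + 1) + 1) / (n + 1))) = κ :=
    funext <| Fin.cases h₀.symm fun i =>
      div_mul_cancel₀ _ (sqrt_two_mul_add_one_div_pos n i).ne'
  rw [hcoeff]

theorem IsSymbolCorrespondence.exists_kernelMatrix (hW : IsSymbolCorrespondence n W) :
    ∃ c : Fin n → ℝ, (∀ i, c i ≠ 0) ∧ IsGivenBy n W (kernelMatrix n c) := by
  obtain ⟨K, hK⟩ := hW.exists_isGivenBy
  obtain ⟨κ, rfl⟩ := hW.exists_kernel_eq_sum_coupled hK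
  have h₀ : κ 0 = Real.sqrt (1 / (n + 1)) := by
    have htrace := trace_coupled_mul_sum_coupled (fun l => (κ l : ℂ)) 0
    rw [Fin.val_zero, coupled_zero, smul_mul_assoc, one_mul, Matrix.trace_smul,
      hW.kernel_trace hK, smul_eq_mul, mul_one, Complex.ofReal_inj] at htrace
    exact htrace.symm
  obtain ⟨c, hc, hcK⟩ := exists_kernelMatrix_eq_sum_coupled h₀ fun l =>
    Complex.ofReal_ne_zero.1 (hK.coeff_ne_zero hW.injective l)
  exact ⟨c, hc, hcK ▸ hK⟩

end IsSymbolCorrespondence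

theorem exists_equiv_symbolCorrespondence (n : ℕ) :
    ∃ Ψ : {c : Fin n → ℝ // ∀ i, c i ≠ 0} ≃
        {W : Op n →ₗ[ℂ] (S2 → ℂ) // IsSymbolCorrespondence n W},
      ∀ c, IsGivenBy n (Ψ c).1 (kernelMatrix n c.1) := by
  choose F hF hFK using fun c : {c : Fin n → ℝ // ∀ i, c i ≠ 0} => exists_isSymbolCorrespondence c.2
  refine ⟨Equiv.ofBijective (fun c => ⟨F c, hF c⟩) ⟨fun c c' h => ?_, ?_⟩, hFK⟩
  · have hFc : F c = F c' := congrArg Subtype.val h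
    exact Subtype.ext (kernelMatrix_injective n ((hFK c).kernel_unique (hFc ▸ hFK c')))
  · rintro ⟨W, hW⟩
    obtain ⟨c, hc, hcW⟩ := hW.exists_kernelMatrix
    exact ⟨⟨c, hc⟩, Subtype.ext ((hFK ⟨c, hc⟩).unique hcW)⟩

/-- The bijection from the tuples of nonzero real numbers onto the kernels. -/
def kernelSetEquiv (n : ℕ) : {c : Fin n → ℝ // ∀ i, c i ≠ 0} ≃ {K : Op n // K ∈ kernelSet n} :=
  Equiv.ofBijective
    (fun c => ⟨kernelMatrix n c.1, exists_kernelMatrix_eq_diagonal n c.1, c.1, c.2, rfl⟩)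
    ⟨fun c c' h => Subtype.ext (kernelMatrix_injective n (congrArg Subtype.val h)), by
      rintro ⟨K, -, c, hc, rfl⟩
      exact ⟨⟨c, hc⟩, rfl⟩⟩

end SpinJ

end

theorem theorem6p2p1 (n : ℕ) :
    (∀ l : ℕ, 1 ≤ l → l ≤ n →
      SpinJ.coupled n l ∈ SpinJ.opSummand n l ∧
      (∃ d : Fin (n + 1) → ℝ, SpinJ.coupled n l = Matrix.diagonal fun i => (d i : ℂ)) ∧
      (SpinJ.coupled n l).trace = 0 ∧
      ((SpinJ.coupled n l)ᴴ * SpinJ.coupled n l).trace = 1) ∧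
    (∃ Φ : {K : SpinJ.Op n // K ∈ SpinJ.kernelSet n} ≃
        {W : SpinJ.Op n →ₗ[ℂ] (SpinJ.S2 → ℂ) // SpinJ.IsSymbolCorrespondence n W},
      ∀ K, SpinJ.IsGivenBy n (Φ K).1 K.1) ∧
    (∃ Ψ : {c : Fin n → ℝ // ∀ i, c i ≠ 0} ≃
        {W : SpinJ.Op n →ₗ[ℂ] (SpinJ.S2 → ℂ) // SpinJ.IsSymbolCorrespondence n W},
      ∀ c, SpinJ.IsGivenBy n (Ψ c).1 (SpinJ.kernelMatrix n c.1)) := by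
  obtain ⟨Ψ, hΨ⟩ := SpinJ.exists_equiv_symbolCorrespondence n
  refine ⟨fun l hl hln => ⟨SpinJ.coupled_mem_opSummand n l, ⟨_, SpinJ.coupled_eq_diagonal n l⟩,
    SpinJ.trace_coupled hl, ?_⟩, ⟨(SpinJ.kernelSetEquiv n).symm.trans Ψ, fun K => ?_⟩, Ψ, hΨ⟩
  · rw [SpinJ.coupled_conjTranspose, SpinJ.trace_coupled_mul_self hln]
  · obtain ⟨c, rfl⟩ := (SpinJ.kernelSetEquiv n).surjective K
    rw [Equiv.trans_apply, Equiv.symm_apply_apply]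
    exact hΨ c
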